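/- A \emph{polyhedral map} $X$ on the plane $\mathbb{R}^2$ is a locally finite decomposition of $\mathbb{R}^2$ into vertices (points), edges (arcs joining two vertices, distinct edges meeting only in vertices) and faces covering the plane, where each face is a closed disc that contains no vertex and no point of an edge in its interior and whose boundary is a cycle of $p\ge 3$ edges through $p$ distinct vertices (a $p$-gon), and any two distinct faces are disjoint, meet in exactly one vertex, or meet in exactly one edge. The faces containing a vertex $v$ form a cyclic sequence, the face-cycle at $v$, in which consecutive faces share an edge through $v$, these edges being pairwise distinct. $X$ is \emph{semi-equivelar of type} $[3^3,4^2]$ if at every vertex the face-cycle consists, in this cyclic order, of three consecutive triangles followed by two consecutive quadrangles. For $k,t\in\mathbb{Z}$, write $t=2j+r$ with $j \in \mathbb{Z}$, $r\in\{0,1\}$, and let $$u_{k,t}=\Bigl(k-\tfrac{j}{2},\; j\bigl(1+\tfrac{\sqrt3}{2}\bigr)+r\Bigr)\in\mathbb{R}^2 .$$ Let $E_1$ be the elongated triangular tiling of $\mathbb{R}^2$: its vertices are the points $u_{k,t}$, its faces are, for $k,j\in\mathbb{Z}$, the unit squares with vertices $u_{k,2j},u_{k+1,2j},u_{k+1,2j+1},u_{k,2j+1}$,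 and the equilateral triangles with vertices $u_{k,2j},u_{k+1,2j},u_{k,2j-1}$, respectively $u_{k,2j-1},u_{k+1,2j-1},u_{k+1,2j}$, and its edges are the sides of these polygons. \textbf{Lemma.} If $X$ is a semi-equivelar polyhedral map of type $[3^3,4^2]$ on $\mathbb{R}^2$, then $X$ is isomorphic to $E_1$, that is, there are bijections between the vertices, between the edges and between the faces of $X$ and of $E_1$ that preserve and reflect incidence. -/

import Mathlib

open Set Topology

/-- A family of (closed) cells in a space `M`: a set of points (vertices), a set of edges and a set
of faces, where edges and faces are given as subsets of `M`. -/
structure CellFamily (M : Type*) where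
  verts : Set M
  edges : Set (Set M)
  faces : Set (Set M)

namespace CellFamily

variable {M N : Type*}

/-- The union of all the vertices and all the edges. -/
def skeleton (X : CellFamily M) : Set M := X.verts ∪ ⋃₀ X.edges

/-- `F` is a polygonal face: for some `p = k + 3 ≥ 3` there are `p` distinct vertices
`c 0, …, c (p - 1)` and edges `E i` with end points `c i` and `c (i + 1)` (indices modulo `p`)
such that `F` is an embedded closed disc whose boundary circle is the union of the `E i`, and the
interior of this disc contains no vertex and no point of an edge. -/
def IsPolygonalFace [TopologicalSpace M] (X : CellFamily M) (F : Set M) : Prop :=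
  ∃ (k : ℕ) (c : Fin (k + 3) → M) (E : Fin (k + 3) → Set M),
    Function.Injective c ∧
    (∀ i, E i ∈ X.edges ∧ E i ∩ X.verts = {c i, c (i + 1)}) ∧
    F ∩ X.skeleton = ⋃ i, E i ∧
    ∃ φ : Metric.closedBall (0 : EuclideanSpace ℝ (Fin 2)) 1 → M,
      IsEmbedding φ ∧ range φ = F ∧
      φ '' {z | ‖(z : EuclideanSpace ℝ (Fin 2))‖ = 1} = ⋃ i, E i

/-- `X` is a polyhedral map on `M`: a locally finite decomposition of `M` into vertices, edges
(arcs) and polygonal faces (closed discs), in which two distinct faces are disjoint, or meet in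
exactly one vertex, or meet in exactly one edge. -/
structure IsPolyhedralMap [TopologicalSpace M] (X : CellFamily M) : Prop where
  edge_arc : ∀ e ∈ X.edges, ∃ γ : unitInterval → M,
    IsEmbedding γ ∧ range γ = e ∧ e ∩ X.verts = {γ 0, γ 1}
  edge_inter : ∀ e ∈ X.edges, ∀ e' ∈ X.edges, e ≠ e' → e ∩ e' ⊆ X.verts
  face_polygon : ∀ F ∈ X.faces, X.IsPolygonalFace F
  face_inter : ∀ F ∈ X.faces, ∀ G ∈ X.faces, F ≠ G →
    F ∩ G = ∅ ∨ (∃ v ∈ X.verts, F ∩ G = {v}) ∨ F ∩ G ∈ X.edges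
  face_cover : ⋃₀ X.faces = univ
  face_locallyFinite : LocallyFinite (fun F : X.faces => (F : Set M))

/-- The number of vertices of a face; `F` is a `p`-gon if this number is `p`. -/
noncomputable def gonality (X : CellFamily M) (F : Set M) : ℕ := (F ∩ X.verts).ncard

/-- `C 0, …, C (d - 1)` is the face-cycle at the vertex `v`: it lists every face containing `v`
exactly once, and (indices modulo `d`) any two consecutive faces share an edge, these `d` edges
being pairwise distinct. -/
def IsFaceCycle (X : CellFamily M) (v : M) {d : ℕ} [NeZero d] (C : Fin d → Set M) : Prop :=
  Function.Injective C ∧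
  range C = {F | F ∈ X.faces ∧ v ∈ F} ∧
  (∀ i, C i ∩ C (i + 1) ∈ X.edges) ∧
  Function.Injective (fun i => C i ∩ C (i + 1))

/-- `X` is semi-equivelar of type `t`, where the type `[p₁^n₁, …, pₖ^nₖ]` is written out as the
cyclic sequence `p₁, …, p₁, …, pₖ, …, pₖ` of length `d = n₁ + ⋯ + nₖ`: at every vertex the faces
of the face-cycle, from a suitable start and in a suitable direction, are
`t 0`-, `t 1`-, …, `t (d - 1)`-gons. -/
def IsSemiEquivelar (X : CellFamily M) {d : ℕ} [NeZero d] (t : Fin d → ℕ) : Prop :=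
  ∀ v ∈ X.verts, ∃ C : Fin d → Set M, X.IsFaceCycle v C ∧ ∀ i, X.gonality (C i) = t i

/-- An isomorphism of maps: bijections between the vertices, the edges and the faces that preserve
and reflect incidence. -/
structure Iso (X : CellFamily M) (Y : CellFamily N) where
  onVerts : X.verts ≃ Y.verts
  onEdges : X.edges ≃ Y.edges
  onFaces : X.faces ≃ Y.faces
  vert_mem_edge : ∀ (v : X.verts) (e : X.edges),
    (v : M) ∈ (e : Set M) ↔ (onVerts v : N) ∈ (onEdges e : Set N)
  vert_mem_face : ∀ (v : X.verts) (F : X.faces),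
    (v : M) ∈ (F : Set M) ↔ (onVerts v : N) ∈ (onFaces F : Set N)
  edge_subset_face : ∀ (e : X.edges) (F : X.faces),
    (e : Set M) ⊆ (F : Set M) ↔ (onEdges e : Set N) ⊆ (onFaces F : Set N)

end CellFamily

namespace ElongatedTriangular

/-- The vertices `u k t` of the elongated triangular tiling with edges of length `1`; `t` is the
number of the row and `k` the position in it. Row `2 j + 1` lies at distance `1` exactly above
row `2 j` (squares in between), and row `2 j + 2` lies above row `2 j + 1` at distance `√3 / 2` and
shifted by `-1 / 2` (equilateral triangles in between). Here `t / 2` is rounded down and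
`t % 2` is `0` or `1`. -/
noncomputable def u (k t : ℤ) : EuclideanSpace ℝ (Fin 2) :=
  !₂[(k : ℝ) - ((t / 2 : ℤ) : ℝ) / 2,
     ((t / 2 : ℤ) : ℝ) * (1 + Real.sqrt 3 / 2) + ((t % 2 : ℤ) : ℝ)]

/-- The elongated triangular tiling of the plane: unit squares between the rows `2 j` and
`2 j + 1`, and equilateral triangles between the rows `2 j - 1` and `2 j`. -/
noncomputable def tiling : CellFamily (EuclideanSpace ℝ (Fin 2)) where
  verts := {x | ∃ k t : ℤ, x = u k t}
  edges := {e | ∃ k j : ℤ,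
    e = segment ℝ (u k j) (u (k + 1) j) ∨
    e = segment ℝ (u k (2 * j)) (u k (2 * j + 1)) ∨
    e = segment ℝ (u k (2 * j - 1)) (u k (2 * j)) ∨
    e = segment ℝ (u k (2 * j - 1)) (u (k + 1) (2 * j))}
  faces := {F | ∃ k j : ℤ,
    F = convexHull ℝ {u k (2 * j), u (k + 1) (2 * j), u (k + 1) (2 * j + 1), u k (2 * j + 1)} ∨
    F = convexHull ℝ {u k (2 * j), u (k + 1) (2 * j), u k (2 * j - 1)} ∨
    F = convexHull ℝ {u k (2 * j - 1), u (k + 1) (2 * j - 1), u (k + 1) (2 * j)}}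

end ElongatedTriangular

/-!
The proof constructs a developing map from the vertices of `X` to `ℤ × ℤ`, the vertices `u k t` of
the tiling being labelled by `(k, t)`.

*Local structure.* At every vertex `v` the face-cycle yields a star (`hasStars`): seven neighbours
and diagonal neighbours in a fixed pattern. An edge is horizontal if it lies in a triangle and in a
quadrangle, and vertical if it lies in two quadrangles; these notions do not refer to a vertex.
Comparing stars at adjacent vertices shows that in every quadrangle two opposite sides are
horizontal and the other two vertical, and that every triangle has exactly one horizontal side
(`HasStars.hor_s_sr`, `HasStars.hor_tl_tr`).

*Global coordinates.* Inside a single face the change of the row number, and of the horizontal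
coordinate, is therefore known, up to the involution `squarePartner` or `trianglePartner` of the set
of rows, respectively up to an isometry of `ℤ`. Each of the two coordinates amounts to a group
valued cocycle on pairs of vertices with a common face, and the coordinate exists globally if this
cocycle is a coboundary. That is where the plane has to be simply connected: the open
stars of the vertices form an open cover, a cocycle on it is the gluing datum of a covering space,
and over a simply connected base such a covering has a section
(`exists_locallyConstant_of_cocycle`, `CellFamily.IsPolyhedralMap.exists_coboundary`). The outcome
is a row number (`HasStars.exists_level`) and a horizontal position (`HasStars.exists_position`),
which together form a map `D` to `ℤ × ℤ` that sends every star onto a star of the model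
(`HasStars.exists_gridStar`).

*Bijectivity.* Since `D` is bijective on stars, the two unit steps of `ℤ × ℤ` lift to permutations
of the vertices of `X`. These commute, because the two paths around a unit square stay within the
faces between two rows, and by connectedness they generate a transitive group. Hence `D` is
bijective (`bijective_of_gridStar`).

*Cells.* In `X` edges and faces are determined by their vertices, an edge lies in a face as soon as
its end points do, and the edges correspond to the pairs of distinct vertices with two common faces.
In the tiling the vertices in a cell are exactly those that span it, as its bounding box contains no
others. So `D` induces bijections of edges and faces that respect incidence.
-/

/-- On a simply connected, locally path connected space, a constant Čech 1-cocycle `g` for an open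
cover `U` with values in a group is the coboundary of a locally constant family `s`: the cocycle
glues the products `U i × G` to a covering, and `s` consists of the coordinates of a global section
of it, which exists because the identity map lifts. -/
theorem exists_locallyConstant_of_cocycle {B ι G : Type*} [TopologicalSpace B]
    [SimplyConnectedSpace B] [LocallyPathConnectedSpace B] [Group G] (U : ι → Set B)
    (hU : ∀ i, IsOpen (U i)) (hcov : ∀ x, ∃ i, x ∈ U i) (g : ι → ι → G)
    (hg : ∀ i j k x, x ∈ U i → x ∈ U j → x ∈ U k → g i j * g j k = g i k) :
    ∃ s : ι → B → G,
      (∀ i, ∀ x ∈ U i, ∀ᶠ y in 𝓝 x, s i y = s i x) ∧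
      ∀ i j x, x ∈ U i → x ∈ U j → g i j * s j x = s i x := by
  classical
  let _ : TopologicalSpace G := ⊥
  have _ : DiscreteTopology G := ⟨rfl⟩
  choose idx hidx using hcov
  have hself : ∀ i x, x ∈ U i → g i i = 1 := fun i x hx => by
    have := hg i i i x hx hx hx
    simpa using this
  let Z : FiberBundleCore ι B G :=
    { baseSet := U
      isOpen_baseSet := hU
      indexAt := idx
      mem_baseSet_at := hidx
      coordChange := fun i j _ a => g j i * a
      coordChange_self := fun i x hx a => by simp [hself i x hx]
      continuousOn_coordChange := fun i j =>
        ((continuous_of_discreteTopology (f := fun a : G => g j i * a)).comp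
          continuous_snd).continuousOn
      coordChange_comp := fun i j k x hx a => by
        rw [← mul_assoc, hg k j i x hx.2 hx.1.2 hx.1.1] }
  have hcovm : IsCoveringMap Z.proj := FiberBundle.isCoveringMap (F := G) (E := Z.Fiber)
  obtain ⟨x₀⟩ : Nonempty B := inferInstance
  obtain ⟨S, ⟨-, hS⟩, -⟩ := hcovm.existsUnique_continuousMap_lifts (ContinuousMap.id B) x₀
    (⟨x₀, (1 : G)⟩ : Z.TotalSpace) rfl
  have hSx : ∀ x, (S x).proj = x := fun x => congrFun hS x
  refine ⟨fun i x => (Z.localTriv i (S x)).2, fun i x hx => ?_, fun i j x hi hj => ?_⟩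
  · have hmem : S x ∈ (Z.localTriv i).source := by
      rw [Z.mem_localTriv_source, ← Z.baseSet_at, hSx]; exact hx
    have hc : ContinuousAt (fun y => (Z.localTriv i (S y)).2) x :=
      continuous_snd.continuousAt.comp
        (((Z.localTriv i).continuousAt hmem).comp S.continuous.continuousAt)
    exact hc.eventually (p := fun z => z = _) (by rw [nhds_discrete]; exact rfl)
  · simp only [Z.localTriv_apply, hSx]
    exact Z.coordChange_comp (idx x) j i x ⟨⟨hidx x, hj⟩, hi⟩ _

/-! ### Incidence of vertices, edges and faces of a polyhedral map -/

namespace CellFamily.IsPolyhedralMap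

variable {M : Type*} [TopologicalSpace M] {X : CellFamily M} (hX : X.IsPolyhedralMap)
include hX

theorem exists_edge_verts {e : Set M} (he : e ∈ X.edges) :
    ∃ a b, a ≠ b ∧ e ∩ X.verts = {a, b} := by
  obtain ⟨γ, hγ, -, h⟩ := hX.edge_arc e he
  exact ⟨γ 0, γ 1, hγ.injective.ne zero_ne_one, h⟩

theorem exists_mem_edge_notMem_verts {e : Set M} (he : e ∈ X.edges) :
    ∃ x ∈ e, x ∉ X.verts := by
  obtain ⟨γ, hγ, hr, h⟩ := hX.edge_arc e he
  let t : unitInterval := ⟨1 / 2, by constructor <;> norm_num⟩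
  refine ⟨γ t, hr ▸ mem_range_self t, fun hv => ?_⟩
  have ht : γ t ∈ e ∩ X.verts := ⟨hr ▸ mem_range_self t, hv⟩
  rw [h] at ht
  rcases ht with ht | ht
  · have := congrArg Subtype.val (hγ.injective ht)
    norm_num [t] at this
  · have := congrArg Subtype.val (hγ.injective ht)
    norm_num [t] at this

theorem edge_eq_of_mem {e e' : Set M} (he : e ∈ X.edges) (he' : e' ∈ X.edges) {x : M}
    (hx : x ∈ e) (hx' : x ∈ e') (hv : x ∉ X.verts) : e = e' :=
  by_contra fun h => hv (hX.edge_inter e he e' he' h ⟨hx, hx'⟩)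

/-- The boundary cycle of a face, without the disc it bounds. -/
theorem exists_cycle {F : Set M} (hF : F ∈ X.faces) :
    ∃ (k : ℕ) (c : Fin (k + 3) → M) (E : Fin (k + 3) → Set M), Function.Injective c ∧
      (∀ i, E i ∈ X.edges) ∧ (∀ i, E i ∩ X.verts = {c i, c (i + 1)}) ∧ (∀ i, E i ⊆ F) ∧
      F ∩ X.verts = range c ∧ ∀ e ∈ X.edges, ∀ x ∈ e, x ∈ F → x ∉ X.verts → ∃ i, e = E i := by
  obtain ⟨k, c, E, hc, hE, hs, -⟩ := hX.face_polygon F hF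
  have hEF : ∀ i, E i ⊆ F := fun i x hx =>
    (hs.symm.subset (mem_iUnion.2 ⟨i, hx⟩)).1
  refine ⟨k, c, E, hc, fun i => (hE i).1, fun i => (hE i).2, hEF, ?_, ?_⟩
  · ext x
    constructor
    · rintro ⟨hxF, hxv⟩
      obtain ⟨i, hi⟩ := mem_iUnion.1 (hs.subset ⟨hxF, Or.inl hxv⟩)
      have : x ∈ E i ∩ X.verts := ⟨hi, hxv⟩
      rw [(hE i).2] at this
      rcases this with h | h
      · exact ⟨i, h.symm⟩
      · exact ⟨i + 1, h.symm⟩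
    · rintro ⟨i, rfl⟩
      have : c i ∈ E i ∩ X.verts := by rw [(hE i).2]; exact Or.inl rfl
      exact ⟨hEF i this.1, this.2⟩
  · intro e he x hxe hxF hxv
    obtain ⟨i, hi⟩ := mem_iUnion.1 (hs.subset ⟨hxF, Or.inr ⟨e, he, hxe⟩⟩)
    exact ⟨i, hX.edge_eq_of_mem he (hE i).1 hxe hi hxv⟩

theorem edge_subset_face_of_mem {F e : Set M} (hF : F ∈ X.faces) (he : e ∈ X.edges) {x : M}
    (hxe : x ∈ e) (hxF : x ∈ F) (hxv : x ∉ X.verts) : e ⊆ F := by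
  obtain ⟨k, c, E, -, -, -, hEF, -, h⟩ := hX.exists_cycle hF
  obtain ⟨i, rfl⟩ := h e he x hxe hxF hxv
  exact hEF i

theorem exists_face_of_edge {e : Set M} (he : e ∈ X.edges) : ∃ F ∈ X.faces, e ⊆ F := by
  obtain ⟨x, hxe, hxv⟩ := hX.exists_mem_edge_notMem_verts he
  obtain ⟨F, hF, hxF⟩ : x ∈ ⋃₀ X.faces := hX.face_cover ▸ mem_univ x
  exact ⟨F, hF, hX.edge_subset_face_of_mem hF he hxe hxF hxv⟩

/-- Two edges of one face with the same end points are equal, because its boundary cycle has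
length at least three. -/
theorem edge_eq_of_subset_face {F e e' : Set M} (hF : F ∈ X.faces) (he : e ∈ X.edges)
    (he' : e' ∈ X.edges) (heF : e ⊆ F) (heF' : e' ⊆ F) (h : e ∩ X.verts = e' ∩ X.verts) :
    e = e' := by
  obtain ⟨k, c, E, hc, -, hEv, -, -, hE⟩ := hX.exists_cycle hF
  obtain ⟨x, hxe, hxv⟩ := hX.exists_mem_edge_notMem_verts he
  obtain ⟨i, rfl⟩ := hE e he x hxe (heF hxe) hxv
  obtain ⟨y, hye, hyv⟩ := hX.exists_mem_edge_notMem_verts he'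
  obtain ⟨j, rfl⟩ := hE e' he' y hye (heF' hye) hyv
  rw [hEv, hEv, pair_eq_pair_iff] at h
  rcases h with ⟨h, -⟩ | ⟨h, h'⟩
  · rw [hc h]
  · have h1 := hc h
    have h2 := hc h'
    rw [h1, add_assoc, add_eq_left] at h2
    simp [Fin.ext_iff, Fin.val_add, Nat.mod_eq_of_lt] at h2

/-- At most two edges of a face pass through a given vertex. -/
theorem not_three_edges {F v : _} (hF : F ∈ X.faces) (hv : v ∈ X.verts) {e₁ e₂ e₃ : Set M}
    (he₁ : e₁ ∈ X.edges) (he₂ : e₂ ∈ X.edges) (he₃ : e₃ ∈ X.edges) (h₁ : e₁ ⊆ F) (h₂ : e₂ ⊆ F)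
    (h₃ : e₃ ⊆ F) (hv₁ : v ∈ e₁) (hv₂ : v ∈ e₂) (hv₃ : v ∈ e₃) (h₁₂ : e₁ ≠ e₂) (h₁₃ : e₁ ≠ e₃) :
    e₂ = e₃ := by
  obtain ⟨k, c, E, hc, -, hEv, -, hFv, hE⟩ := hX.exists_cycle hF
  obtain ⟨m, rfl⟩ : v ∈ range c := hFv.subset ⟨h₁ hv₁, hv⟩
  have key : ∀ e ∈ X.edges, e ⊆ F → c m ∈ e → e = E m ∨ e = E (m - 1) := by
    intro e he heF hve
    obtain ⟨x, hxe, hxv⟩ := hX.exists_mem_edge_notMem_verts he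
    obtain ⟨i, rfl⟩ := hE e he x hxe (heF hxe) hxv
    have : c m ∈ E i ∩ X.verts := ⟨hve, hv⟩
    rw [hEv] at this
    rcases this with h | h
    · exact Or.inl (by rw [hc h])
    · exact Or.inr (by rw [hc h, add_sub_cancel_right])
  rcases key e₁ he₁ h₁ hv₁ with a | a <;> rcases key e₂ he₂ h₂ hv₂ with b | b <;>
    rcases key e₃ he₃ h₃ hv₃ with d | d <;> simp_all

theorem inter_mem_edges {F G : Set M} (hF : F ∈ X.faces) (hG : G ∈ X.faces) (hFG : F ≠ G)
    {a b : M} (hab : a ≠ b) (ha : a ∈ F ∩ G) (hb : b ∈ F ∩ G) : F ∩ G ∈ X.edges := by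
  rcases hX.face_inter F hF G hG hFG with h | ⟨v, -, h⟩ | h
  · rw [h] at ha; exact ha.elim
  · rw [h] at ha hb; exact (hab (ha.trans hb.symm)).elim
  · exact h

theorem edge_verts_eq {e : Set M} (he : e ∈ X.edges) {a b : M} (hab : a ≠ b)
    (ha : a ∈ e ∩ X.verts) (hb : b ∈ e ∩ X.verts) : e ∩ X.verts = {a, b} := by
  obtain ⟨c, d, hcd, h⟩ := hX.exists_edge_verts he
  rw [h] at ha hb ⊢
  rcases ha with rfl | rfl <;> rcases hb with rfl | rfl
  · exact (hab rfl).elim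
  · rfl
  · exact pair_comm _ _
  · exact (hab rfl).elim

/-- A face that contains the end points of an edge contains the edge. -/
theorem edge_subset_face {F e : Set M} (hF : F ∈ X.faces) (he : e ∈ X.edges)
    (h : e ∩ X.verts ⊆ F) : e ⊆ F := by
  obtain ⟨G, hG, heG⟩ := hX.exists_face_of_edge he
  by_cases hFG : F = G
  · exact hFG ▸ heG
  obtain ⟨a, b, hab, hv⟩ := hX.exists_edge_verts he
  have ha : a ∈ e ∩ X.verts := hv ▸ Or.inl rfl
  have hb : b ∈ e ∩ X.verts := hv ▸ Or.inr rfl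
  have hi := hX.inter_mem_edges hF hG hFG hab ⟨h ha, heG ha.1⟩ ⟨h hb, heG hb.1⟩
  have : e = F ∩ G := hX.edge_eq_of_subset_face hG he hi heG inter_subset_right (by
    rw [hv, hX.edge_verts_eq hi hab ⟨⟨h ha, heG ha.1⟩, ha.2⟩ ⟨⟨h hb, heG hb.1⟩, hb.2⟩])
  exact this ▸ inter_subset_left

/-- An edge is determined by its end points. -/
theorem edge_eq_of_verts_eq {e e' : Set M} (he : e ∈ X.edges) (he' : e' ∈ X.edges)
    (h : e ∩ X.verts = e' ∩ X.verts) : e = e' := by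
  obtain ⟨G, hG, heG⟩ := hX.exists_face_of_edge he
  exact hX.edge_eq_of_subset_face hG he he' heG
    (hX.edge_subset_face hG he' (h ▸ fun x hx => heG hx.1)) h

/-- A face is determined by its vertices. -/
theorem face_eq_of_verts_eq {F G : Set M} (hF : F ∈ X.faces) (hG : G ∈ X.faces)
    (h : F ∩ X.verts = G ∩ X.verts) : F = G := by
  by_contra hFG
  obtain ⟨k, c, E, hc, -, -, -, hFv, -⟩ := hX.exists_cycle hF
  have hm : ∀ i, c i ∈ (F ∩ G) ∩ X.verts := fun i => by
    have h1 : c i ∈ F ∩ X.verts := hFv ▸ mem_range_self i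
    exact ⟨⟨h1.1, (h ▸ h1 : c i ∈ G ∩ X.verts).1⟩, h1.2⟩
  have h01 : c 0 ≠ c 1 := hc.ne (by simp)
  have he := hX.inter_mem_edges hF hG hFG h01 (hm 0).1 (hm 1).1
  have h2 := hm 2
  rw [hX.edge_verts_eq he h01 (hm 0) (hm 1)] at h2
  rcases h2 with h2 | h2
  · have := hc h2
    simp [Fin.ext_iff, Nat.mod_eq_of_lt] at this
  · have := hc h2
    simp [Fin.ext_iff, Nat.mod_eq_of_lt] at this

end CellFamily.IsPolyhedralMap

/-! ### Open stars, cocycles and connectedness -/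

namespace CellFamily

/-- The open star of `v`: the points all of whose faces contain `v`. -/
def openStar {M : Type*} (X : CellFamily M) (v : M) : Set M :=
  {x | ∀ F ∈ X.faces, x ∈ F → v ∈ F}

namespace IsPolyhedralMap

variable {M : Type*} [TopologicalSpace M] {X : CellFamily M} (hX : X.IsPolyhedralMap)
include hX

theorem isClosed_face [T2Space M] {F : Set M} (hF : F ∈ X.faces) : IsClosed F := by
  obtain ⟨k, c, E, -, -, -, φ, hφ, hr, -⟩ := hX.face_polygon F hF
  have : CompactSpace (Metric.closedBall (0 : EuclideanSpace ℝ (Fin 2)) 1) :=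
    isCompact_iff_compactSpace.1 (isCompact_closedBall _ _)
  exact hr ▸ (isCompact_range hφ.continuous).isClosed

theorem isOpen_openStar [T2Space M] (v : M) : IsOpen (X.openStar v) := by
  have h := (hX.face_locallyFinite.subset
    (g := fun F : X.faces => {x | x ∈ (F : Set M) ∧ v ∉ (F : Set M)})
    (fun F x hx => hx.1)).isClosed_iUnion (fun F => by
      by_cases hv : v ∈ (F : Set M)
      · simp [hv]
      · simpa [hv] using hX.isClosed_face F.2)
  convert h.isOpen_compl using 1
  ext x
  simp [openStar]

/-- Every face contains a dense connected set of points that lie in no other face: the interior of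
the disc. -/
theorem exists_face_interior {F : Set M} (hF : F ∈ X.faces) :
    ∃ O ⊆ F, O.Nonempty ∧ IsPreconnected O ∧ F ⊆ closure O ∧
      ∀ x ∈ O, ∀ G ∈ X.faces, x ∈ G → G = F := by
  obtain ⟨k, c, E, -, -, hs, φ, hφ, hr, hb⟩ := hX.face_polygon F hF
  let B : Set (Metric.closedBall (0 : EuclideanSpace ℝ (Fin 2)) 1) := {z | ‖z.1‖ < 1}
  have hB : Subtype.val '' B = Metric.ball (0 : EuclideanSpace ℝ (Fin 2)) 1 := by
    ext z
    simp only [B, mem_image, mem_ofPred_eq, Subtype.exists, Metric.mem_closedBall,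
      dist_zero_right, Metric.mem_ball, exists_and_left, exists_prop]
    constructor
    · rintro ⟨z, h, -, rfl⟩; exact h
    · intro h; exact ⟨z, h, h.le, rfl⟩
  have hBc : IsPreconnected B := by
    rw [← IsInducing.subtypeVal.isPreconnected_image, hB]
    exact (convex_ball _ _).isPreconnected
  have hBd : closure B = univ := by
    rw [IsInducing.subtypeVal.closure_eq_preimage_closure_image, hB,
      closure_ball _ one_ne_zero]
    exact eq_univ_of_forall fun z => z.2
  have hsub : φ '' B ⊆ F := hr ▸ image_subset_range _ _
  refine ⟨φ '' B, hsub, ?_, hBc.image _ hφ.continuous.continuousOn, ?_, ?_⟩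
  · exact ⟨φ ⟨0, by simp⟩, ⟨0, by simp⟩, by simp [B], rfl⟩
  · rw [← hr, ← image_univ, ← hBd]
    exact image_closure_subset_closure_image hφ.continuous
  · rintro _ ⟨z, hz, rfl⟩ G hG hzG
    by_contra hGF
    have hzF : φ z ∈ F := hsub ⟨z, hz, rfl⟩
    have hsk : φ z ∈ X.skeleton := by
      rcases hX.face_inter G hG F hF hGF with h | ⟨v, hv, h⟩ | h
      · exact (h.subset ⟨hzG, hzF⟩).elim
      · exact Or.inl ((h.subset ⟨hzG, hzF⟩ : φ z = v) ▸ hv)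
      · exact Or.inr ⟨_, h, hzG, hzF⟩
    obtain ⟨y, hy, hyz⟩ := hb.symm.subset (hs.subset ⟨hzF, hsk⟩)
    rw [hφ.injective hyz] at hy
    exact (ne_of_lt hz) hy

theorem exists_vert_mem_face {F : Set M} (hF : F ∈ X.faces) : ∃ v ∈ X.verts, v ∈ F := by
  obtain ⟨k, c, -, -, -, -, -, h, -⟩ := hX.exists_cycle hF
  have : c 0 ∈ F ∩ X.verts := h ▸ mem_range_self 0
  exact ⟨c 0, this.2, this.1⟩

/-- The open stars of the vertices cover the space: a point in a single face lies in the open star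
of each vertex of it, a point of an edge in those of both end points, and a vertex in its own. -/
theorem exists_mem_openStar (x : M) : ∃ v : X.verts, x ∈ X.openStar v := by
  by_cases hx : x ∈ X.verts
  · exact ⟨⟨x, hx⟩, fun F _ h => h⟩
  obtain ⟨F, hF, hxF⟩ : x ∈ ⋃₀ X.faces := hX.face_cover ▸ mem_univ x
  have hedge : ∀ G ∈ X.faces, x ∈ G → F ≠ G → F ∩ G ∈ X.edges := fun G hG hxG hFG => by
    rcases hX.face_inter F hF G hG hFG with h | ⟨v, hv, h⟩ | h
    · exact (h.subset ⟨hxF, hxG⟩).elim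
    · exact (hx ((h.subset ⟨hxF, hxG⟩ : x = v) ▸ hv)).elim
    · exact h
  by_cases h : ∃ G ∈ X.faces, x ∈ G ∧ F ≠ G
  · obtain ⟨G, hG, hxG, hFG⟩ := h
    have he := hedge G hG hxG hFG
    obtain ⟨a, b, -, hab⟩ := hX.exists_edge_verts he
    have ha : a ∈ (F ∩ G) ∩ X.verts := hab ▸ Or.inl rfl
    refine ⟨⟨a, ha.2⟩, fun H hH hxH => ?_⟩
    by_cases hFH : F = H
    · exact hFH ▸ ha.1.1
    · have := hX.edge_eq_of_mem he (hedge H hH hxH hFH) ⟨hxF, hxG⟩ ⟨hxF, hxH⟩ hx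
      exact (this.subset ha.1).2
  · obtain ⟨v, hv, hvF⟩ := hX.exists_vert_mem_face hF
    refine ⟨⟨v, hv⟩, fun G hG hxG => ?_⟩
    have : F = G := by_contra fun hFG => h ⟨G, hG, hxG, hFG⟩
    exact this ▸ hvF

/-- On a simply connected space a group valued cocycle on the pairs of vertices with a common face
is a coboundary. -/
theorem exists_coboundary [T2Space M] [SimplyConnectedSpace M] [LocallyPathConnectedSpace M]
    {G : Type*} [Group G] (g : X.verts → X.verts → G)
    (hg : ∀ F ∈ X.faces, ∀ u v w : X.verts, (u : M) ∈ F → (v : M) ∈ F → (w : M) ∈ F →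
      g u v * g v w = g u w) :
    ∃ h : X.verts → G, ∀ F ∈ X.faces, ∀ u v : X.verts, (u : M) ∈ F → (v : M) ∈ F →
      g u v * h v = h u := by
  obtain ⟨s, hs, hgs⟩ := exists_locallyConstant_of_cocycle (fun v : X.verts => X.openStar v)
    (fun v => hX.isOpen_openStar v) hX.exists_mem_openStar g (fun u v w x hu hv hw => by
      obtain ⟨F, hF, hxF⟩ : x ∈ ⋃₀ X.faces := hX.face_cover ▸ mem_univ x
      exact hg F hF u v w (hu F hF hxF) (hv F hF hxF) (hw F hF hxF))
  refine ⟨fun v => s v v, fun F hF u v hu hv => ?_⟩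
  obtain ⟨O, hOF, ⟨x, hx⟩, hO, hFO, hOG⟩ := hX.exists_face_interior hF
  -- `O ∪ {w}` lies between `O` and its closure, and in the open star of `w`.
  have key : ∀ w : X.verts, (w : M) ∈ F → x ∈ X.openStar w ∧ s w x = s w w := by
    intro w hw
    have hsub : insert (w : M) O ⊆ X.openStar w := by
      rintro y (rfl | hy) G hG hyG
      · exact hyG
      · exact (hOG y hy G hG hyG).symm ▸ hw
    refine ⟨hsub (Or.inr hx), ?_⟩
    have hP : IsPreconnected (insert (w : M) O) := hO.subset_closure (subset_insert _ _)
      (insert_subset (hFO hw) subset_closure)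
    let _ : TopologicalSpace G := ⊥
    have _ : DiscreteTopology G := ⟨rfl⟩
    refine hP.constant (f := s w) (fun y hy => ?_) (Or.inr hx) (Or.inl rfl)
    exact (continuousAt_const.congr ((hs w y (hsub hy)).mono fun z hz =>
      hz.symm)).continuousWithinAt
  change g u v * s v v = s u u
  rw [← (key u hu).2, ← (key v hv).2]
  exact hgs u v x (key u hu).1 (key v hv).1

/-- On a connected space, any two vertices are joined by a chain of vertices in which consecutive
ones have a common face. -/
theorem eq_univ_of_face_closed [T2Space M] [PreconnectedSpace M] (S : Set X.verts)
    (hS : S.Nonempty)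
    (h : ∀ F ∈ X.faces, ∀ u v : X.verts, (u : M) ∈ F → (v : M) ∈ F → u ∈ S → v ∈ S) :
    S = univ := by
  have hopen : ∀ T : Set X.verts, IsOpen (⋃ v ∈ T, X.openStar (v : M)) := fun T =>
    isOpen_biUnion fun v _ => hX.isOpen_openStar v
  have hcompl : (⋃ v ∈ S, X.openStar (v : M))ᶜ = ⋃ v ∈ Sᶜ, X.openStar (v : M) := by
    ext x
    simp only [mem_compl_iff, mem_iUnion, exists_prop, not_exists, not_and]
    constructor
    · intro hx
      obtain ⟨v, hv⟩ := hX.exists_mem_openStar x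
      exact ⟨v, fun hvS => hx v hvS hv, hv⟩
    · rintro ⟨v, hvS, hv⟩ u huS hu
      obtain ⟨F, hF, hxF⟩ : x ∈ ⋃₀ X.faces := hX.face_cover ▸ mem_univ x
      exact hvS (h F hF u v (hu F hF hxF) (hv F hF hxF) huS)
  have hclopen : IsClopen (⋃ v ∈ S, X.openStar (v : M)) :=
    ⟨⟨hcompl ▸ hopen _⟩, hopen _⟩
  rcases isClopen_iff.1 hclopen with h0 | h1
  · obtain ⟨v, hv⟩ := hS
    have : (v : M) ∈ ⋃ v ∈ S, X.openStar (v : M) := mem_biUnion hv fun F _ h => h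
    rw [h0] at this
    exact this.elim
  · refine eq_univ_of_forall fun v => ?_
    have hv : (v : M) ∈ ⋃ v ∈ S, X.openStar (v : M) := h1 ▸ mem_univ _
    simp only [mem_iUnion, exists_prop] at hv
    obtain ⟨u, huS, hu⟩ := hv
    obtain ⟨F, hF, hvF⟩ : (v : M) ∈ ⋃₀ X.faces := hX.face_cover ▸ mem_univ (v : M)
    exact h F hF u v (hu F hF hvF) hvF huS

end IsPolyhedralMap

end CellFamily

/-! ### Stars, horizontal and vertical edges -/

/-- In a complex on the vertex set `V` with triangles `𝓣` and quadrangles `𝓠`, the faces at `v` are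
the triangles `v l tl`, `v tl tr`, `v tr r` and the quadrangles `v r sr s`, `v s sl l`, in this
cyclic order. The letters stand for right, left, square and triangle. -/
structure IsStar {V : Type*} (𝓣 𝓠 : Set (Set V)) (v r l s sr sl tr tl : V) : Prop where
  nodup : [v, r, l, s, sr, sl, tr, tl].Nodup
  tri_iff : ∀ A, A ∈ 𝓣 ∧ v ∈ A ↔ A = {v, l, tl} ∨ A = {v, tl, tr} ∨ A = {v, tr, r}
  quad_iff : ∀ A, A ∈ 𝓠 ∧ v ∈ A ↔ A = {v, r, sr, s} ∨ A = {v, s, sl, l}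

/-- The edge `a b` is horizontal: it lies in a triangle and in a quadrangle. -/
def Hor {V : Type*} (𝓣 𝓠 : Set (Set V)) (a b : V) : Prop :=
  a ≠ b ∧ (∃ A ∈ 𝓣, a ∈ A ∧ b ∈ A) ∧ ∃ A ∈ 𝓠, a ∈ A ∧ b ∈ A

/-- The edge `a b` is vertical: it lies in two quadrangles. -/
def Vert {V : Type*} (𝓠 : Set (Set V)) (a b : V) : Prop :=
  a ≠ b ∧ ∃ A ∈ 𝓠, ∃ B ∈ 𝓠, A ≠ B ∧ (a ∈ A ∧ b ∈ A) ∧ a ∈ B ∧ b ∈ B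

section Local

variable {V : Type*} {𝓣 𝓠 : Set (Set V)} {a b c v r l s sr sl tr tl : V} {A B : Set V}

theorem Hor.symm (h : Hor 𝓣 𝓠 a b) : Hor 𝓣 𝓠 b a := by
  obtain ⟨h, ⟨A, hA, h1, h2⟩, B, hB, h3, h4⟩ := h
  exact ⟨h.symm, ⟨A, hA, h2, h1⟩, B, hB, h4, h3⟩

theorem Vert.symm (h : Vert 𝓠 a b) : Vert 𝓠 b a := by
  obtain ⟨h, A, hA, B, hB, hAB, h1, h2⟩ := h
  exact ⟨h.symm, A, hA, B, hB, hAB, h1.symm, h2.symm⟩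

namespace IsStar

theorem ne (h : IsStar 𝓣 𝓠 v r l s sr sl tr tl) :
      (v ≠ r ∧ v ≠ l ∧ v ≠ s ∧ v ≠ sr ∧ v ≠ sl ∧ v ≠ tr ∧ v ≠ tl) ∧
      (r ≠ l ∧ r ≠ s ∧ r ≠ sr ∧ r ≠ sl ∧ r ≠ tr ∧ r ≠ tl) ∧
      (l ≠ s ∧ l ≠ sr ∧ l ≠ sl ∧ l ≠ tr ∧ l ≠ tl) ∧
      (s ≠ sr ∧ s ≠ sl ∧ s ≠ tr ∧ s ≠ tl) ∧
      (sr ≠ sl ∧ sr ≠ tr ∧ sr ≠ tl) ∧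
      (sl ≠ tr ∧ sl ≠ tl) ∧
      (tr ≠ tl) := by
  have := h.nodup
  simpa only [List.nodup_cons, List.mem_cons, List.not_mem_nil, not_or, or_false, not_false_eq_true,
    List.nodup_nil, and_true, ne_eq, and_assoc] using this

/-- A star read in the opposite direction. -/
theorem mirror (h : IsStar 𝓣 𝓠 v r l s sr sl tr tl) : IsStar 𝓣 𝓠 v l r s sl sr tl tr where
  nodup := by have := h.nodup; grind
  tri_iff A := by
    rw [h.tri_iff, pair_comm tr tl, pair_comm r tr, pair_comm tl l]
    tauto
  quad_iff A := by
    have h1 : ({v, r, sr, s} : Set V) = {v, s, sr, r} := by grind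
    have h2 : ({v, s, sl, l} : Set V) = {v, l, sl, s} := by grind
    rw [h.quad_iff, h1, h2]
    tauto

theorem hor_iff (h : IsStar 𝓣 𝓠 v r l s sr sl tr tl) : Hor 𝓣 𝓠 v a ↔ a = r ∨ a = l := by
  have hn := h.ne
  constructor
  · rintro ⟨hva, ⟨A, hA, h1, h2⟩, B, hB, h3, h4⟩
    have hA := (h.tri_iff A).1 ⟨hA, h1⟩
    have hB := (h.quad_iff B).1 ⟨hB, h3⟩
    grind
  · have hA₁ := (h.tri_iff {v, l, tl}).2 (by grind)
    have hA₂ := (h.tri_iff {v, tr, r}).2 (by grind)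
    have hB₁ := (h.quad_iff {v, r, sr, s}).2 (by grind)
    have hB₂ := (h.quad_iff {v, s, sl, l}).2 (by grind)
    rintro (rfl | rfl)
    · exact ⟨by grind, ⟨_, hA₂.1, by grind⟩, _, hB₁.1, by grind⟩
    · exact ⟨by grind, ⟨_, hA₁.1, by grind⟩, _, hB₂.1, by grind⟩

theorem vert_iff (h : IsStar 𝓣 𝓠 v r l s sr sl tr tl) : Vert 𝓠 v a ↔ a = s := by
  have hn := h.ne
  constructor
  · rintro ⟨hva, A, hA, B, hB, hAB, ⟨h1, h2⟩, h3, h4⟩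
    have hA := (h.quad_iff A).1 ⟨hA, h1⟩
    have hB := (h.quad_iff B).1 ⟨hB, h3⟩
    grind
  · rintro rfl
    have hB₁ := (h.quad_iff {v, r, sr, a}).2 (by grind)
    have hB₂ := (h.quad_iff {v, a, sl, l}).2 (by grind)
    refine ⟨by grind, _, hB₁.1, _, hB₂.1, fun he => ?_, by grind⟩
    have : r ∈ ({v, a, sl, l} : Set V) := he ▸ (by grind)
    grind

theorem not_hor_of_vert (h : IsStar 𝓣 𝓠 v r l s sr sl tr tl) (hv : Vert 𝓠 v a) :
    ¬Hor 𝓣 𝓠 v a := by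
  have hn := h.ne
  rw [h.hor_iff]
  rw [h.vert_iff] at hv
  grind

/-- A face has at most one horizontal edge at each of its vertices. -/
theorem hor_unique (h : IsStar 𝓣 𝓠 v r l s sr sl tr tl) (hA : A ∈ 𝓣 ∨ A ∈ 𝓠) (hv : v ∈ A)
    (ha : a ∈ A) (hb : b ∈ A) (hva : Hor 𝓣 𝓠 v a) (hvb : Hor 𝓣 𝓠 v b) : a = b := by
  have hn := h.ne
  rw [h.hor_iff] at hva hvb
  rcases hA with hA | hA
  · have hA := (h.tri_iff A).1 ⟨hA, hv⟩
    grind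
  · have hA := (h.quad_iff A).1 ⟨hA, hv⟩
    grind

theorem exists_hor (h : IsStar 𝓣 𝓠 v r l s sr sl tr tl) (hA : A ∈ 𝓠) (hv : v ∈ A) :
    ∃ b ∈ A, Hor 𝓣 𝓠 v b := by
  simp only [h.hor_iff]
  have hA := (h.quad_iff A).1 ⟨hA, hv⟩
  grind

theorem exists_vert (h : IsStar 𝓣 𝓠 v r l s sr sl tr tl) (hA : A ∈ 𝓠) (hv : v ∈ A) :
    ∃ b ∈ A, Vert 𝓠 v b := by
  simp only [h.vert_iff]
  have hA := (h.quad_iff A).1 ⟨hA, hv⟩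
  grind

/-- Only the middle one of the three triangles at a vertex has no horizontal edge at that vertex. -/
theorem eq_of_forall_not_hor (h : IsStar 𝓣 𝓠 v r l s sr sl tr tl) (hA : A ∈ 𝓣) (hvA : v ∈ A)
    (hB : B ∈ 𝓣) (hvB : v ∈ B) (hA' : ∀ b ∈ A, ¬Hor 𝓣 𝓠 v b) (hB' : ∀ b ∈ B, ¬Hor 𝓣 𝓠 v b) :
    A = B := by
  simp only [h.hor_iff] at hA' hB'
  have hA := (h.tri_iff A).1 ⟨hA, hvA⟩
  have hB := (h.tri_iff B).1 ⟨hB, hvB⟩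
  grind

theorem exists_quad_iff (h : IsStar 𝓣 𝓠 v r l s sr sl tr tl) :
    (∃ A ∈ 𝓠, v ∈ A ∧ a ∈ A) ↔ a = v ∨ a = r ∨ a = sr ∨ a = s ∨ a = sl ∨ a = l := by
  constructor
  · rintro ⟨A, hA, hv, hx⟩
    rcases (h.quad_iff A).1 ⟨hA, hv⟩ with rfl | rfl <;>
    · simp only [mem_insert_iff, mem_singleton_iff] at hx
      tauto
  · intro hx
    have hB₁ := (h.quad_iff {v, r, sr, s}).2 (Or.inl rfl)
    have hB₂ := (h.quad_iff {v, s, sl, l}).2 (Or.inr rfl)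
    have : a ∈ ({v, r, sr, s} : Set V) ∨ a ∈ ({v, s, sl, l} : Set V) := by
      simp only [mem_insert_iff, mem_singleton_iff]
      tauto
    rcases this with hx | hx
    · exact ⟨_, hB₁.1, hB₁.2, hx⟩
    · exact ⟨_, hB₂.1, hB₂.2, hx⟩

theorem exists_tri_iff (h : IsStar 𝓣 𝓠 v r l s sr sl tr tl) :
    (∃ A ∈ 𝓣, v ∈ A ∧ a ∈ A) ↔ a = v ∨ a = r ∨ a = tr ∨ a = tl ∨ a = l := by
  constructor
  · rintro ⟨A, hA, hv, hx⟩
    rcases (h.tri_iff A).1 ⟨hA, hv⟩ with rfl | rfl | rfl <;>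
    · simp only [mem_insert_iff, mem_singleton_iff] at hx
      tauto
  · intro hx
    have hB₁ := (h.tri_iff {v, l, tl}).2 (Or.inl rfl)
    have hB₂ := (h.tri_iff {v, tr, r}).2 (Or.inr (Or.inr rfl))
    have : a ∈ ({v, l, tl} : Set V) ∨ a ∈ ({v, tr, r} : Set V) := by
      simp only [mem_insert_iff, mem_singleton_iff]
      tauto
    rcases this with hx | hx
    · exact ⟨_, hB₁.1, hB₁.2, hx⟩
    · exact ⟨_, hB₂.1, hB₂.2, hx⟩

end IsStar

end Local

/-- Every vertex has a star. -/
def HasStars {V : Type*} (𝓣 𝓠 : Set (Set V)) : Prop :=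
  ∀ v, ∃ r l s sr sl tr tl, IsStar 𝓣 𝓠 v r l s sr sl tr tl

namespace HasStars

variable {V : Type*} {𝓣 𝓠 : Set (Set V)} (hS : HasStars 𝓣 𝓠)
  {a b c v r l s sr sl tr tl : V} {A B : Set V}
include hS

theorem not_hor_of_vert (hv : Vert 𝓠 a b) : ¬Hor 𝓣 𝓠 a b := by
  obtain ⟨r, l, s, sr, sl, tr, tl, h⟩ := hS a
  exact h.not_hor_of_vert hv

theorem hor_unique (hA : A ∈ 𝓣 ∨ A ∈ 𝓠) (hv : v ∈ A)
    (ha : a ∈ A) (hb : b ∈ A) (hva : Hor 𝓣 𝓠 v a) (hvb : Hor 𝓣 𝓠 v b) : a = b := by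
  obtain ⟨r, l, s, sr, sl, tr, tl, h⟩ := hS v
  exact h.hor_unique hA hv ha hb hva hvb

theorem vert_unique (hva : Vert 𝓠 v a) (hvb : Vert 𝓠 v b) : a = b := by
  obtain ⟨r, l, s, sr, sl, tr, tl, h⟩ := hS v
  rw [h.vert_iff] at hva hvb
  rw [hva, hvb]

/-- The side of a quadrangle opposite to a horizontal side is horizontal: at `s` the quadrangle has
some horizontal side, and the side `s v` is vertical. -/
theorem hor_s_sr (h : IsStar 𝓣 𝓠 v r l s sr sl tr tl) : Hor 𝓣 𝓠 s sr := by
  have hn := h.ne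
  have hA := ((h.quad_iff {v, r, sr, s}).2 (by grind)).1
  obtain ⟨_, _, _, _, _, _, _, hs⟩ := hS s
  obtain ⟨b, hbA, hb⟩ := hs.exists_hor hA (by grind)
  have hsv : Vert 𝓠 s v := (h.vert_iff.2 rfl).symm
  rcases hbA with rfl | rfl | rfl | rfl
  · exact (hS.not_hor_of_vert hsv hb).elim
  · have := hS.hor_unique (Or.inr hA) (v := b) (a := v) (b := s) (by grind) (by grind) (by grind)
      (h.hor_iff.2 (by grind)).symm hb.symm
    grind
  · exact hb
  · exact (hb.1 rfl).elim

/-- The side of a quadrangle opposite to a vertical side is vertical. -/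
theorem vert_r_sr (h : IsStar 𝓣 𝓠 v r l s sr sl tr tl) : Vert 𝓠 r sr := by
  have hn := h.ne
  have hA := ((h.quad_iff {v, r, sr, s}).2 (by grind)).1
  obtain ⟨_, _, _, _, _, _, _, hr⟩ := hS r
  obtain ⟨b, hbA, hb⟩ := hr.exists_vert hA (by grind)
  have hsv : Vert 𝓠 s v := (h.vert_iff.2 rfl).symm
  have hrv : Hor 𝓣 𝓠 r v := (h.hor_iff.2 (by grind)).symm
  rcases hbA with rfl | rfl | rfl | rfl
  · exact (hS.not_hor_of_vert hb hrv).elim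
  · exact (hb.1 rfl).elim
  · exact hb
  · have := hS.vert_unique hsv hb.symm
    grind

theorem not_hor_l_tl (h : IsStar 𝓣 𝓠 v r l s sr sl tr tl) : ¬Hor 𝓣 𝓠 l tl := by
  intro hl
  have hn := h.ne
  have hA := ((h.tri_iff {v, l, tl}).2 (by grind)).1
  have := hS.hor_unique (Or.inl hA) (v := l) (a := v) (b := tl) (by grind) (by grind) (by grind)
      (h.hor_iff.2 (by grind)).symm hl
  grind

/-- The third side of the middle triangle at `v` is horizontal. Otherwise this triangle has no
horizontal side at `tl`, so the neighbouring triangle `v l tl` has one at `tl`, although it already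
has the horizontal side `v l`. -/
theorem hor_tl_tr (h : IsStar 𝓣 𝓠 v r l s sr sl tr tl) : Hor 𝓣 𝓠 tl tr := by
  by_contra hc
  have hn := h.ne
  have hA := ((h.tri_iff {v, tl, tr}).2 (by grind)).1
  have hB := ((h.tri_iff {v, l, tl}).2 (by grind)).1
  have hv : ¬Hor 𝓣 𝓠 tl v := fun h' => by
    have := h.hor_iff.1 h'.symm
    grind
  obtain ⟨_, _, _, _, _, _, _, ht⟩ := hS tl
  have := ht.eq_of_forall_not_hor hA (by grind) hB (by grind) ?_ ?_
  · have : l ∈ ({v, tl, tr} : Set V) := this ▸ (by grind)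
    grind
  · rintro b (rfl | rfl | rfl)
    · exact hv
    · exact fun h' => h'.1 rfl
    · exact hc
  · rintro b (rfl | rfl | rfl)
    · exact hv
    · exact fun h' => hS.not_hor_l_tl h h'.symm
    · exact fun h' => h'.1 rfl

/-- Two vertices of a face that are both on another level than a third one are on the same level. -/
theorem hor_of_not_hor (hA : A ∈ 𝓣 ∨ A ∈ 𝓠) (hv : v ∈ A) (ha : a ∈ A) (hb : b ∈ A)
    (hva : ¬(v = a ∨ Hor 𝓣 𝓠 v a)) (hvb : ¬(v = b ∨ Hor 𝓣 𝓠 v b)) :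
    a = b ∨ Hor 𝓣 𝓠 a b := by
  obtain ⟨r, l, s, sr, sl, tr, tl, h⟩ := hS v
  have h1 := hS.hor_tl_tr h
  have h2 := hS.hor_s_sr h
  have h3 := hS.hor_s_sr h.mirror
  have h1' := h1.symm
  have h2' := h2.symm
  have h3' := h3.symm
  rw [h.hor_iff] at hva hvb
  rcases hA with hA | hA
  · rcases (h.tri_iff A).1 ⟨hA, hv⟩ with rfl | rfl | rfl <;> grind
  · rcases (h.quad_iff A).1 ⟨hA, hv⟩ with rfl | rfl <;> grind

end HasStars

/-! ### The row number -/

/-- The level joined to the level `t` by squares. -/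
def squarePartner : Equiv.Perm ℤ :=
  Function.Involutive.toPerm (fun t => if t % 2 = 0 then t + 1 else t - 1) (fun t => by grind)

/-- The level joined to the level `t` by triangles. -/
def trianglePartner : Equiv.Perm ℤ :=
  Function.Involutive.toPerm (fun t => if t % 2 = 0 then t - 1 else t + 1) (fun t => by grind)

theorem squarePartner_apply (t : ℤ) : squarePartner t = if t % 2 = 0 then t + 1 else t - 1 := rfl

theorem trianglePartner_apply (t : ℤ) :
    trianglePartner t = if t % 2 = 0 then t - 1 else t + 1 := rfl

theorem squarePartner_mul_self : squarePartner * squarePartner = 1 := by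
  ext t
  simp only [Equiv.Perm.mul_apply, squarePartner_apply, Equiv.Perm.one_apply]
  grind

theorem trianglePartner_mul_self : trianglePartner * trianglePartner = 1 := by
  ext t
  simp only [Equiv.Perm.mul_apply, trianglePartner_apply, Equiv.Perm.one_apply]
  grind

/-- Every group valued cocycle on the pairs of vertices with a common face is a coboundary. -/
def TrivialCocycles {V : Type*} (𝓣 𝓠 : Set (Set V)) : Prop :=
  ∀ (G : Type) [Group G] (g : V → V → G),
    (∀ A, A ∈ 𝓣 ∨ A ∈ 𝓠 → ∀ u ∈ A, ∀ v ∈ A, ∀ w ∈ A, g u v * g v w = g u w) →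
    ∃ h : V → G, ∀ A, A ∈ 𝓣 ∨ A ∈ 𝓠 → ∀ u ∈ A, ∀ v ∈ A, g u v * h v = h u

namespace HasStars

variable {V : Type*} {𝓣 𝓠 : Set (Set V)} (hS : HasStars 𝓣 𝓠)
  {a b c v r l s sr sl tr tl : V} {A B : Set V}
include hS

/-- There is a global numbering of the horizontal rows: passing from a row to the next one across
squares or across triangles is described by the involutions `squarePartner` and
`trianglePartner`. -/
theorem exists_level (hH : TrivialCocycles 𝓣 𝓠) :
    ∃ T : V → ℤ, ∀ v r l s sr sl tr tl, IsStar 𝓣 𝓠 v r l s sr sl tr tl →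
      T r = T v ∧ T l = T v ∧ T s = squarePartner (T v) ∧ T sr = squarePartner (T v) ∧
      T sl = squarePartner (T v) ∧ T tr = trianglePartner (T v) ∧
      T tl = trianglePartner (T v) := by
  classical
  let g : V → V → Equiv.Perm ℤ := fun a b =>
    if a = b ∨ Hor 𝓣 𝓠 a b then 1
    else if ∃ A ∈ 𝓠, a ∈ A ∧ b ∈ A then squarePartner else trianglePartner
  -- on a face, `g` is the level change of the kind of this face
  have hgA : ∀ A, A ∈ 𝓣 ∨ A ∈ 𝓠 → ∃ ρ : Equiv.Perm ℤ, ρ * ρ = 1 ∧ ∀ a ∈ A, ∀ b ∈ A,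
      g a b = if a = b ∨ Hor 𝓣 𝓠 a b then 1 else ρ := by
    rintro A (hA | hA)
    · refine ⟨trianglePartner, trianglePartner_mul_self, fun a ha b hb => ?_⟩
      by_cases h : a = b ∨ Hor 𝓣 𝓠 a b
      · simp [g, h]
      · have : ¬∃ A ∈ 𝓠, a ∈ A ∧ b ∈ A := fun hq =>
          h (Or.inr ⟨fun h' => h (Or.inl h'), ⟨A, hA, ha, hb⟩, hq⟩)
        simp only [g, if_neg h, if_neg this]
    · refine ⟨squarePartner, squarePartner_mul_self, fun a ha b hb => ?_⟩
      have : ∃ A ∈ 𝓠, a ∈ A ∧ b ∈ A := ⟨A, hA, ha, hb⟩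
      simp only [g, if_pos this]
  -- The cocycle identity holds because on a face "equal or horizontal" is an equivalence relation
  -- with two classes, and `ρ` is an involution.
  obtain ⟨h, hh⟩ := hH (Equiv.Perm ℤ) g (fun A hA u hu v hv w hw => by
    obtain ⟨ρ, hρ, hg⟩ := hgA A hA
    rw [hg u hu v hv, hg v hv w hw, hg u hu w hw]
    have h1 : (v = u ∨ Hor 𝓣 𝓠 v u) ↔ (u = v ∨ Hor 𝓣 𝓠 u v) :=
      or_congr eq_comm ⟨Hor.symm, Hor.symm⟩
    have h2 := hS.hor_of_not_hor hA hv hu hw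
    have h3 := hS.hor_unique hA hv hu hw
    have h4 := hS.hor_unique hA hu hv hw
    have h5 := hS.hor_unique hA hw hv hu
    have h6 : ∀ a b, Hor 𝓣 𝓠 a b → Hor 𝓣 𝓠 b a := fun a b => Hor.symm
    by_cases c1 : u = v ∨ Hor 𝓣 𝓠 u v <;> by_cases c2 : v = w ∨ Hor 𝓣 𝓠 v w <;>
      by_cases c3 : u = w ∨ Hor 𝓣 𝓠 u w <;> simp only [c1, c2, c3, if_true, if_false, one_mul,
        mul_one, hρ] <;> grind)
  have hT : ∀ A, A ∈ 𝓣 ∨ A ∈ 𝓠 → ∀ u ∈ A, ∀ v ∈ A, h u 0 = g u v (h v 0) := by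
    intro A hA u hu v hv
    rw [← hh A hA u hu v hv]
    rfl
  refine ⟨fun v => h v 0, fun v r l s sr sl tr tl hst => ?_⟩
  have hn := hst.ne
  have hA₁ := (hst.tri_iff {v, l, tl}).2 (by simp)
  have hA₃ := (hst.tri_iff {v, tr, r}).2 (by simp)
  have hB₁ := (hst.quad_iff {v, r, sr, s}).2 (by simp)
  have hB₂ := (hst.quad_iff {v, s, sl, l}).2 (by simp)
  have hhor : ∀ x, Hor 𝓣 𝓠 x v ↔ x = r ∨ x = l := fun x =>
    ⟨fun h => hst.hor_iff.1 h.symm, fun h => (hst.hor_iff.2 h).symm⟩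
  have hq : ∀ x, (∃ A ∈ 𝓠, x ∈ A ∧ v ∈ A) ↔
      x = v ∨ x = r ∨ x = sr ∨ x = s ∨ x = sl ∨ x = l := fun x => by
    simp only [and_comm (a := x ∈ _), hst.exists_quad_iff]
  have e1 := hT _ (Or.inr hB₁.1) r (by simp) v hB₁.2
  have e2 := hT _ (Or.inr hB₂.1) l (by simp) v hB₂.2
  have e3 := hT _ (Or.inr hB₁.1) s (by simp) v hB₁.2
  have e4 := hT _ (Or.inr hB₁.1) sr (by simp) v hB₁.2
  have e5 := hT _ (Or.inr hB₂.1) sl (by simp) v hB₂.2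
  have e6 := hT _ (Or.inl hA₃.1) tr (by simp) v hA₃.2
  have e7 := hT _ (Or.inl hA₁.1) tl (by simp) v hA₁.2
  simp only [g, hhor, hq] at e1 e2 e3 e4 e5 e6 e7
  simp only [true_or, or_true, if_true, Equiv.Perm.one_apply] at e1 e2
  rw [if_neg (by clear * - hn; grind), if_pos (by simp)] at e3 e4 e5
  rw [if_neg (by clear * - hn; grind), if_neg (by clear * - hn; grind)] at e6 e7
  exact ⟨e1, e2, e3, e4, e5, e6, e7⟩

end HasStars

/-! ### Isometries of the integers -/

section IntIsometry

theorem IsometryEquiv.abs_sub_int (σ : ℤ ≃ᵢ ℤ) (a b : ℤ) : |σ a - σ b| = |a - b| := by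
  have := σ.isometry.dist_eq a b
  rw [Int.dist_eq, Int.dist_eq] at this
  exact_mod_cast this

theorem IsometryEquiv.int_ext {σ τ : ℤ ≃ᵢ ℤ} {x y : ℤ} (hxy : x ≠ y) (hx : σ x = τ x)
    (hy : σ y = τ y) : σ = τ := by
  ext t
  have h1 := σ.abs_sub_int t x
  have h2 := τ.abs_sub_int t x
  have h3 := σ.abs_sub_int t y
  have h4 := τ.abs_sub_int t y
  have h5 := σ.abs_sub_int x y
  rw [abs_eq_abs] at h1 h2 h3 h4 h5
  omega

/-- Two families of integers with the same distances differ by an isometry of the integers. -/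
theorem exists_isometry_of_abs_sub_eq {α : Type*} (S : Set α) (f g : α → ℤ)
    (h : ∀ a ∈ S, ∀ b ∈ S, |f a - f b| = |g a - g b|) :
    ∃ σ : ℤ ≃ᵢ ℤ, ∀ a ∈ S, f a = σ (g a) := by
  have key : ∃ s c : ℤ, (s = 1 ∨ s = -1) ∧ ∀ a ∈ S, f a = s * g a + c := by
    rcases S.eq_empty_or_nonempty with rfl | ⟨x, hx⟩
    · exact ⟨1, 0, Or.inl rfl, by simp⟩
    by_cases hc : ∀ a ∈ S, g a = g x
    · refine ⟨1, f x - g x, Or.inl rfl, fun a ha => ?_⟩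
      have h1 := h a ha x hx
      rw [hc a ha, sub_self, abs_zero, abs_eq_zero] at h1
      rw [hc a ha]
      omega
    · push Not at hc
      obtain ⟨y, hy, hyx⟩ := hc
      rcases abs_eq_abs.1 (h y hy x hx) with h1 | h1
      · refine ⟨1, f x - g x, Or.inl rfl, fun a ha => ?_⟩
        have h2 := abs_eq_abs.1 (h a ha x hx)
        have h3 := abs_eq_abs.1 (h a ha y hy)
        omega
      · refine ⟨-1, f x + g x, Or.inr rfl, fun a ha => ?_⟩
        have h2 := abs_eq_abs.1 (h a ha x hx)
        have h3 := abs_eq_abs.1 (h a ha y hy)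
        omega
  obtain ⟨s, c, hs, hsc⟩ := key
  refine ⟨IsometryEquiv.mk' (fun t => s * t + c) (fun t => s * (t - c)) (fun t => ?_) ?_, hsc⟩
  · rcases hs with rfl | rfl <;> ring
  · refine Isometry.of_dist_eq fun a b => ?_
    rw [Int.dist_eq, Int.dist_eq]
    have : |(s * a + c) - (s * b + c)| = |a - b| := by
      rcases hs with rfl | rfl
      · congr 1; ring
      · rw [← abs_neg]; congr 1; ring
    exact_mod_cast this

end IntIsometry

/-! ### The horizontal coordinate -/

open Classical in
/-- The distance of the horizontal coordinates of two vertices of a common face, in units of half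
an edge. -/
noncomputable def horDist {V : Type*} (𝓣 𝓠 : Set (Set V)) (a b : V) : ℤ :=
  if a = b then 0 else if Hor 𝓣 𝓠 a b then 2 else if ∃ A ∈ 𝓣, a ∈ A ∧ b ∈ A then 1
  else if Vert 𝓠 a b then 0 else 2

/-- `x` is the horizontal coordinate relative to `v` on the faces of a star at `v`. -/
structure IsChart {V : Type*} (𝓣 𝓠 : Set (Set V)) (x : V → ℤ) (v r l s sr sl tr tl : V) :
    Prop where
  isStar : IsStar 𝓣 𝓠 v r l s sr sl tr tl
  v_eq : x v = 0
  r_eq : x r = 2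
  l_eq : x l = -2
  s_eq : x s = 0
  sr_eq : x sr = 2
  sl_eq : x sl = -2
  tr_eq : x tr = 1
  tl_eq : x tl = -1

section

variable {V : Type*} {𝓣 𝓠 : Set (Set V)} {a b c v r l s sr sl tr tl : V} {A B : Set V}

theorem horDist_self : horDist 𝓣 𝓠 a a = 0 := by simp [horDist]

theorem horDist_comm : horDist 𝓣 𝓠 a b = horDist 𝓣 𝓠 b a := by
  classical
  have h1 : Hor 𝓣 𝓠 a b ↔ Hor 𝓣 𝓠 b a := ⟨Hor.symm, Hor.symm⟩
  have h2 : Vert 𝓠 a b ↔ Vert 𝓠 b a := ⟨Vert.symm, Vert.symm⟩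
  have h0 : a = b ↔ b = a := eq_comm
  have h3 : (∃ A ∈ 𝓣, a ∈ A ∧ b ∈ A) ↔ ∃ A ∈ 𝓣, b ∈ A ∧ a ∈ A := by simp only [and_comm]
  exact if_congr h0 rfl (if_congr h1 rfl (if_congr h3 rfl (if_congr h2 rfl rfl)))

theorem Hor.horDist_eq (h : Hor 𝓣 𝓠 a b) : horDist 𝓣 𝓠 a b = 2 := by
  simp [horDist, h, h.1]

theorem horDist_of_tri (hA : A ∈ 𝓣) (ha : a ∈ A) (hb : b ∈ A) (hab : a ≠ b)
    (h : ¬Hor 𝓣 𝓠 a b) : horDist 𝓣 𝓠 a b = 1 := by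
  have : ∃ A ∈ 𝓣, a ∈ A ∧ b ∈ A := ⟨A, hA, ha, hb⟩
  simp only [horDist, hab, h, this, if_true, if_false]

theorem HasStars.horDist_of_vert (hS : HasStars 𝓣 𝓠) (h : Vert 𝓠 a b) :
    horDist 𝓣 𝓠 a b = 0 := by
  have h1 := hS.not_hor_of_vert h
  have h2 : ¬∃ A ∈ 𝓣, a ∈ A ∧ b ∈ A := fun ht => by
    obtain ⟨hab, A, hA, -, -, -, hh, -⟩ := h
    exact h1 ⟨hab, ht, A, hA, hh⟩
  simp only [horDist, h.1, h, h1, h2, if_true, if_false]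

theorem horDist_of_quad (hA : A ∈ 𝓠) (ha : a ∈ A) (hb : b ∈ A) (hab : a ≠ b)
    (h : ¬Vert 𝓠 a b) : horDist 𝓣 𝓠 a b = 2 := by
  by_cases h1 : Hor 𝓣 𝓠 a b
  · exact h1.horDist_eq
  have h2 : ¬∃ A ∈ 𝓣, a ∈ A ∧ b ∈ A := fun ht => h1 ⟨hab, ht, A, hA, ha, hb⟩
  simp only [horDist, hab, h, h1, h2, if_false]

theorem vert_of_horDist_eq_zero (hab : a ≠ b) (h : horDist 𝓣 𝓠 a b = 0) :
    Vert 𝓠 a b ∧ ¬∃ A ∈ 𝓣, a ∈ A ∧ b ∈ A := by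
  unfold horDist at h
  rw [if_neg hab] at h
  split_ifs at h with h1 h2 h3
  · norm_num at h
  · norm_num at h
  · exact ⟨h3, h2⟩
  · norm_num at h

theorem IsStar.exists_chart (h : IsStar 𝓣 𝓠 v r l s sr sl tr tl) :
    ∃ x, IsChart 𝓣 𝓠 x v r l s sr sl tr tl := by
  classical
  have hn := h.ne
  refine ⟨fun w => if w = r ∨ w = sr then 2 else if w = l ∨ w = sl then -2 else
    if w = tr then 1 else if w = tl then -1 else 0, h, ?_, ?_, ?_, ?_, ?_, ?_, ?_, ?_⟩ <;>
  · clear h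
    grind

namespace IsChart

variable {x : V → ℤ}

theorem abs_sub_eq (hS : HasStars 𝓣 𝓠) (hx : IsChart 𝓣 𝓠 x v r l s sr sl tr tl)
    (hA : A ∈ 𝓣 ∨ A ∈ 𝓠) (hv : v ∈ A) (ha : a ∈ A) (hb : b ∈ A) :
    |x a - x b| = horDist 𝓣 𝓠 a b := by
  obtain ⟨h, x0, x1, x2, x3, x4, x5, x6, x7⟩ := hx
  have hn := h.ne
  rcases hA with hA | hA
  · -- distances in the triangle `v tr r`, and in the mirror image `v tl l`
    have side : ∀ {r l s sr sl tr tl}, IsStar 𝓣 𝓠 v r l s sr sl tr tl →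
        horDist 𝓣 𝓠 v r = 2 ∧ horDist 𝓣 𝓠 v tr = 1 ∧ horDist 𝓣 𝓠 r tr = 1 := by
      intro r l s sr sl tr tl h
      have hn := h.ne
      have hA := ((h.tri_iff {v, tr, r}).2 (by simp)).1
      refine ⟨(h.hor_iff.2 (Or.inl rfl)).horDist_eq,
        horDist_of_tri hA (by simp) (by simp) (by clear * - hn; grind) ?_,
        horDist_of_tri hA (by simp) (by simp) (by clear * - hn; grind)
          (hS.not_hor_l_tl h.mirror)⟩
      rw [h.hor_iff]
      clear * - hn; grind
    obtain ⟨d1, d2, d3⟩ := side h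
    obtain ⟨d4, d5, d6⟩ := side h.mirror
    have d7 := (hS.hor_tl_tr h).horDist_eq
    rcases (h.tri_iff A).1 ⟨hA, hv⟩ with rfl | rfl | rfl <;>
    simp only [mem_insert_iff, mem_singleton_iff] at ha hb <;>
    rcases ha with rfl | rfl | rfl <;> rcases hb with rfl | rfl | rfl <;>
    first
    | simp only [horDist_self, sub_self, abs_zero]
    | simp only [x0, x1, x2, x6, x7, d1, d2, d3, d4, d5, d6, d7]; rfl
    | rw [horDist_comm]; simp only [x0, x1, x2, x6, x7, d1, d2, d3, d4, d5, d6, d7]; rfl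
  · have side : ∀ {r l s sr sl tr tl}, IsStar 𝓣 𝓠 v r l s sr sl tr tl →
        horDist 𝓣 𝓠 v r = 2 ∧ horDist 𝓣 𝓠 v s = 0 ∧ horDist 𝓣 𝓠 v sr = 2 ∧
        horDist 𝓣 𝓠 r s = 2 ∧ horDist 𝓣 𝓠 r sr = 0 ∧ horDist 𝓣 𝓠 s sr = 2 := by
      intro r l s sr sl tr tl h
      have hn := h.ne
      have hA := ((h.quad_iff {v, r, sr, s}).2 (by simp)).1
      refine ⟨(h.hor_iff.2 (Or.inl rfl)).horDist_eq, hS.horDist_of_vert (h.vert_iff.2 rfl),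
        horDist_of_quad hA (by simp) (by simp) (by clear * - hn; grind) ?_,
        horDist_of_quad hA (by simp) (by simp) (by clear * - hn; grind) ?_,
        hS.horDist_of_vert (hS.vert_r_sr h), (hS.hor_s_sr h).horDist_eq⟩
      · rw [h.vert_iff]
        clear * - hn; grind
      · intro hrs
        have := hS.vert_unique hrs.symm (h.vert_iff.2 rfl).symm
        clear * - hn this; grind
    obtain ⟨d1, d2, d3, d4, d5, d6⟩ := side h
    obtain ⟨e1, -, e3, e4, e5, e6⟩ := side h.mirror
    rcases (h.quad_iff A).1 ⟨hA, hv⟩ with rfl | rfl <;>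
    simp only [mem_insert_iff, mem_singleton_iff] at ha hb <;>
    rcases ha with rfl | rfl | rfl | rfl <;> rcases hb with rfl | rfl | rfl | rfl <;>
    first
    | simp only [horDist_self, sub_self, abs_zero]
    | simp only [x0, x1, x2, x3, x4, x5, d1, d2, d3, d4, d5, d6, e1, e3, e4, e5, e6]; rfl
    | rw [horDist_comm]
      simp only [x0, x1, x2, x3, x4, x5, d1, d2, d3, d4, d5, d6, e1, e3, e4, e5, e6]; rfl

/-- Opposite horizontal neighbours of `v`, or of the vertex across the vertical edge at `v`, have
opposite coordinates. -/
theorem add_eq (hS : HasStars 𝓣 𝓠) (hx : IsChart 𝓣 𝓠 x v r l s sr sl tr tl)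
    (hc : c = v ∨ Vert 𝓠 v c) (ha : Hor 𝓣 𝓠 c a) (hb : Hor 𝓣 𝓠 c b) (hab : a ≠ b) :
    x a + x b = 2 * x c := by
  obtain ⟨h, x0, x1, x2, x3, x4, x5, x6, x7⟩ := hx
  rcases hc with rfl | hc
  · rw [h.hor_iff] at ha hb
    grind
  · rw [h.vert_iff] at hc
    subst hc
    have h1 := hS.hor_s_sr h
    have h2 := hS.hor_s_sr h.mirror
    have hn : sr ≠ sl := by have := h.ne; clear * - this; grind
    obtain ⟨_, _, _, _, _, _, _, hs⟩ := hS c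
    rw [hs.hor_iff] at ha hb h1 h2
    have : (a = sr ∧ b = sl) ∨ (a = sl ∧ b = sr) := by
      clear * - ha hb h1 h2 hn hab; grind
    rcases this with ⟨rfl, rfl⟩ | ⟨rfl, rfl⟩ <;> omega

end IsChart

end

namespace HasStars

variable {V : Type*} {𝓣 𝓠 : Set (Set V)} (hS : HasStars 𝓣 𝓠)
include hS

/-- The charts at two vertices differ by one isometry of the integers on all the faces that contain
both. -/
theorem exists_transition (x : V → V → ℤ)
    (hx : ∀ v, ∃ r l s sr sl tr tl, IsChart 𝓣 𝓠 (x v) v r l s sr sl tr tl) (u v : V) :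
    ∃ σ : ℤ ≃ᵢ ℤ, ∀ A, A ∈ 𝓣 ∨ A ∈ 𝓠 → u ∈ A → v ∈ A → ∀ w ∈ A, x u w = σ (x v w) := by
  obtain ⟨_, _, _, _, _, _, _, hu⟩ := hx u
  obtain ⟨r, l, s, sr, sl, tr, tl, hv⟩ := hx v
  by_cases huv : u = v
  · subst huv
    exact ⟨1, fun _ _ _ _ _ _ => rfl⟩
  by_cases hA₀ : ∃ A, (A ∈ 𝓣 ∨ A ∈ 𝓠) ∧ u ∈ A ∧ v ∈ A
  swap
  · exact ⟨1, fun A hA hu hv => (hA₀ ⟨A, hA, hu, hv⟩).elim⟩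
  obtain ⟨A₀, hA₀, hu₀, hv₀⟩ := hA₀
  have htr : ∀ A, A ∈ 𝓣 ∨ A ∈ 𝓠 → u ∈ A → v ∈ A →
      ∃ σ : ℤ ≃ᵢ ℤ, ∀ w ∈ A, x u w = σ (x v w) := fun A hA hAu hAv =>
    exists_isometry_of_abs_sub_eq A _ _ fun a ha b hb => by
      rw [hu.abs_sub_eq hS hA hAu ha hb, hv.abs_sub_eq hS hA hAv ha hb]
  obtain ⟨σ, hσ⟩ := htr A₀ hA₀ hu₀ hv₀
  refine ⟨σ, fun A hA hAu hAv => ?_⟩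
  by_cases hAA : A = A₀
  · exact hAA ▸ hσ
  obtain ⟨τ, hτ⟩ := htr A hA hAu hAv
  suffices h : σ = τ from h ▸ hτ
  by_cases h0 : x v u = x v v
  swap
  · exact IsometryEquiv.int_ext h0 (by rw [← hσ u hu₀, hτ u hAu]) (by rw [← hσ v hv₀, hτ v hAv])
  -- Now `u v` is vertical and the two faces are the quadrangles on both sides of it. The left and
  -- the right neighbours of `v` have opposite coordinates in both charts.
  have hd := hv.abs_sub_eq hS hA₀ hv₀ hu₀ hv₀
  rw [h0, sub_self, abs_zero] at hd
  obtain ⟨hvert, hnt⟩ := vert_of_horDist_eq_zero huv hd.symm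
  have hA₀q : A₀ ∈ 𝓠 := hA₀.resolve_left fun h => hnt ⟨A₀, h, hu₀, hv₀⟩
  have hAq : A ∈ 𝓠 := hA.resolve_left fun h => hnt ⟨A, h, hAu, hAv⟩
  have hst := hv.isStar
  have hr := hst.hor_iff.2 (Or.inl rfl)
  have hl := hst.hor_iff.2 (Or.inr rfl)
  have hrl : r ≠ l := hst.ne.2.1.1
  have hsum := hu.add_eq hS (Or.inr hvert) hr hl hrl
  have e0 := hv.v_eq
  have er := hv.r_eq
  have el := hv.l_eq
  have hσv := hσ v hv₀
  have hτv := hτ v hAv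
  rw [e0] at hσv hτv
  have i1 := σ.abs_sub_int 2 0
  have i2 := σ.abs_sub_int (-2) 0
  have i3 := σ.abs_sub_int 2 (-2)
  have j1 := τ.abs_sub_int 2 0
  have j2 := τ.abs_sub_int (-2) 0
  have j3 := τ.abs_sub_int 2 (-2)
  have hcases : (r ∈ A₀ ∧ l ∈ A) ∨ (l ∈ A₀ ∧ r ∈ A) := by
    rcases (hst.quad_iff A₀).1 ⟨hA₀q, hv₀⟩ with rfl | rfl <;>
      rcases (hst.quad_iff A).1 ⟨hAq, hAv⟩ with rfl | rfl <;> simp_all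
  have h2 : σ 2 = τ 2 := by
    rcases hcases with ⟨h1, h2⟩ | ⟨h1, h2⟩
    · have k1 := hσ r h1
      have k2 := hτ l h2
      rw [er] at k1
      rw [el] at k2
      grind
    · have k1 := hσ l h1
      have k2 := hτ r h2
      rw [el] at k1
      rw [er] at k2
      grind
  exact IsometryEquiv.int_ext (x := 0) (y := 2) (by norm_num) (hσv.symm.trans hτv) h2

/-- There is a global horizontal coordinate, in units of half an edge. The stars are mirrored where
necessary, so that `r` is always on the side of the larger coordinate. -/
theorem exists_position (hH : TrivialCocycles 𝓣 𝓠) :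
    ∃ X : V → ℤ, ∀ v, ∃ r l s sr sl tr tl, IsStar 𝓣 𝓠 v r l s sr sl tr tl ∧
      X r = X v + 2 ∧ X l = X v - 2 ∧ X s = X v ∧ X sr = X v + 2 ∧ X sl = X v - 2 ∧
      X tr = X v + 1 ∧ X tl = X v - 1 := by
  have hx : ∀ v, ∃ x, ∃ r l s sr sl tr tl, IsChart 𝓣 𝓠 x v r l s sr sl tr tl := fun v => by
    obtain ⟨r, l, s, sr, sl, tr, tl, h⟩ := hS v
    obtain ⟨x, hx⟩ := h.exists_chart
    exact ⟨x, r, l, s, sr, sl, tr, tl, hx⟩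
  choose x hx using hx
  -- The transitions `g u v` form a cocycle, since an isometry of `ℤ` is determined by two values
  -- and every face has two vertices with different coordinates. If `h` trivializes this cocycle,
  -- the charts `(h v)⁻¹ ∘ x v` agree on common faces.
  choose g hg using hS.exists_transition x hx
  obtain ⟨h, hh⟩ := hH (ℤ ≃ᵢ ℤ) g (fun A hA u hu v hv w hw => by
    obtain ⟨r, l, s, sr, sl, tr, tl, hc⟩ := hx w
    -- two vertices of `A` with different coordinates
    obtain ⟨b, hb, hbw⟩ : ∃ b ∈ A, x w b ≠ x w w := by
      rcases hA with hA | hA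
      · rcases (hc.isStar.tri_iff A).1 ⟨hA, hw⟩ with rfl | rfl | rfl
        · exact ⟨l, by simp, by rw [hc.l_eq, hc.v_eq]; norm_num⟩
        · exact ⟨tr, by simp, by rw [hc.tr_eq, hc.v_eq]; norm_num⟩
        · exact ⟨r, by simp, by rw [hc.r_eq, hc.v_eq]; norm_num⟩
      · rcases (hc.isStar.quad_iff A).1 ⟨hA, hw⟩ with rfl | rfl
        · exact ⟨r, by simp, by rw [hc.r_eq, hc.v_eq]; norm_num⟩
        · exact ⟨l, by simp, by rw [hc.l_eq, hc.v_eq]; norm_num⟩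
    have key : ∀ a ∈ A, (g u v * g v w) (x w a) = g u w (x w a) := fun a ha => by
      rw [IsometryEquiv.mul_apply, ← hg v w A hA hv hw a ha, ← hg u v A hA hu hv a ha,
        ← hg u w A hA hu hw a ha]
    exact IsometryEquiv.int_ext hbw (key b hb) (key w hw))
  have hX : ∀ v A, A ∈ 𝓣 ∨ A ∈ 𝓠 → v ∈ A → ∀ w ∈ A, (h w)⁻¹ 0 = (h v)⁻¹ (x v w) := by
    intro v A hA hv w hw
    obtain ⟨_, _, _, _, _, _, _, hc⟩ := hx w
    have h1 := hg w v A hA hw hv w hw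
    rw [hc.v_eq] at h1
    rw [h1, ← hh A hA w hw v hv, mul_inv_rev, IsometryEquiv.mul_apply,
      IsometryEquiv.inv_apply_self]
  refine ⟨fun w => (h w)⁻¹ 0, fun v => ?_⟩
  obtain ⟨r, l, s, sr, sl, tr, tl, hc⟩ := hx v
  have hst := hc.isStar
  have hA₁ := (hst.tri_iff {v, l, tl}).2 (by simp)
  have hA₃ := (hst.tri_iff {v, tr, r}).2 (by simp)
  have hB₁ := (hst.quad_iff {v, r, sr, s}).2 (by simp)
  have hB₂ := (hst.quad_iff {v, s, sl, l}).2 (by simp)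
  have er := hX v _ (Or.inr hB₁.1) hB₁.2 r (by simp)
  have el := hX v _ (Or.inr hB₂.1) hB₂.2 l (by simp)
  have es := hX v _ (Or.inr hB₁.1) hB₁.2 s (by simp)
  have esr := hX v _ (Or.inr hB₁.1) hB₁.2 sr (by simp)
  have esl := hX v _ (Or.inr hB₂.1) hB₂.2 sl (by simp)
  have etr := hX v _ (Or.inl hA₃.1) hA₃.2 tr (by simp)
  have etl := hX v _ (Or.inl hA₁.1) hA₁.2 tl (by simp)
  rw [hc.r_eq] at er
  rw [hc.l_eq] at el
  rw [hc.s_eq] at es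
  rw [hc.sr_eq] at esr
  rw [hc.sl_eq] at esl
  rw [hc.tr_eq] at etr
  rw [hc.tl_eq] at etl
  simp only
  set σ := (h v)⁻¹
  have i1 := σ.abs_sub_int 2 0
  have i2 := σ.abs_sub_int (-2) 0
  have i3 := σ.abs_sub_int 2 (-2)
  have i4 := σ.abs_sub_int 1 0
  have i5 := σ.abs_sub_int 1 2
  have i6 := σ.abs_sub_int (-1) 0
  have i7 := σ.abs_sub_int (-1) (-2)
  rw [abs_eq_abs] at i1 i2 i3 i4 i5 i6 i7
  by_cases hor : σ 2 = σ 0 + 2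
  · exact ⟨r, l, s, sr, sl, tr, tl, hst, by omega, by omega, by omega, by omega, by omega,
      by omega, by omega⟩
  · exact ⟨l, r, s, sl, sr, tl, tr, hst.mirror, by omega, by omega, by omega, by omega, by omega,
      by omega, by omega⟩

end HasStars

/-! ### The combinatorial model and the developing map -/

/-- The triangles of the combinatorial model on `ℤ × ℤ`; the second coordinate is the row. -/
def gridTri : Set (Set (ℤ × ℤ)) :=
  {A | ∃ k j : ℤ, A = {(k, 2 * j), (k + 1, 2 * j), (k, 2 * j - 1)} ∨
    A = {(k, 2 * j - 1), (k + 1, 2 * j - 1), (k + 1, 2 * j)}}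

/-- The quadrangles of the combinatorial model on `ℤ × ℤ`. -/
def gridQuad : Set (Set (ℤ × ℤ)) :=
  {A | ∃ k j : ℤ, A = {(k, 2 * j), (k + 1, 2 * j), (k + 1, 2 * j + 1), (k, 2 * j + 1)}}

/-- The edges of the combinatorial model on `ℤ × ℤ`, as pairs of vertices. -/
def gridEdge : Set (Set (ℤ × ℤ)) :=
  {A | ∃ k j : ℤ, A = {(k, j), (k + 1, j)} ∨ A = {(k, 2 * j), (k, 2 * j + 1)} ∨
    A = {(k, 2 * j - 1), (k, 2 * j)} ∨ A = {(k, 2 * j - 1), (k + 1, 2 * j)}}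

theorem pair_mem_gridEdge {p q : ℤ × ℤ} : {p, q} ∈ gridEdge ↔
    (q.2 = p.2 ∧ (q.1 = p.1 + 1 ∨ q.1 = p.1 - 1)) ∨
    (q.1 = p.1 ∧ (q.2 = p.2 + 1 ∨ q.2 = p.2 - 1)) ∨
    (p.2 % 2 = 1 ∧ q.1 = p.1 + 1 ∧ q.2 = p.2 + 1) ∨
    (p.2 % 2 = 0 ∧ q.1 = p.1 - 1 ∧ q.2 = p.2 - 1) := by
  obtain ⟨a, b⟩ := p
  obtain ⟨c, d⟩ := q
  simp only [gridEdge, mem_ofPred_eq, pair_eq_pair_iff, Prod.mk.injEq]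
  constructor
  · rintro ⟨k, j, h⟩
    rcases h with (h | h) | (h | h) | (h | h) | (h | h) <;> omega
  · rintro (⟨rfl, rfl | rfl⟩ | ⟨rfl, rfl | rfl⟩ | ⟨h, rfl, rfl⟩ | ⟨h, rfl, rfl⟩)
    · exact ⟨a, d, Or.inl (Or.inl (by omega))⟩
    · exact ⟨a - 1, d, Or.inl (Or.inr (by omega))⟩
    · rcases Int.emod_two_eq_zero_or_one b with hb | hb
      · exact ⟨c, b / 2, Or.inr (Or.inl (Or.inl (by omega)))⟩
      · exact ⟨c, (b + 1) / 2, Or.inr (Or.inr (Or.inl (Or.inl (by omega))))⟩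
    · rcases Int.emod_two_eq_zero_or_one b with hb | hb
      · exact ⟨c, b / 2, Or.inr (Or.inr (Or.inl (Or.inr (by omega))))⟩
      · exact ⟨c, (b - 1) / 2, Or.inr (Or.inl (Or.inr (by omega)))⟩
    · exact ⟨a, (b + 1) / 2, Or.inr (Or.inr (Or.inr (Or.inl (by omega))))⟩
    · exact ⟨a - 1, b / 2, Or.inr (Or.inr (Or.inr (Or.inr (by omega))))⟩

/-- `v` and `w` are the end points of an edge: they lie in two common faces. -/
def Adjacent {V : Type*} (𝓣 𝓠 : Set (Set V)) (v w : V) : Prop :=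
  v ≠ w ∧ ∃ A B, A ≠ B ∧ (A ∈ 𝓣 ∨ A ∈ 𝓠) ∧ (B ∈ 𝓣 ∨ B ∈ 𝓠) ∧ (v ∈ A ∧ w ∈ A) ∧ v ∈ B ∧ w ∈ B

/-- `D` maps a star at `v` onto the star of `D v` in the model. -/
structure IsGridStar {V : Type*} (𝓣 𝓠 : Set (Set V)) (D : V → ℤ × ℤ)
    (v r l s sr sl tr tl : V) : Prop where
  isStar : IsStar 𝓣 𝓠 v r l s sr sl tr tl
  r_eq : D r = D v + (1, 0)
  l_eq : D l = D v + (-1, 0)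
  even : (D v).2 % 2 = 0 → D s = D v + (0, 1) ∧ D sr = D v + (1, 1) ∧ D sl = D v + (-1, 1) ∧
    D tr = D v + (0, -1) ∧ D tl = D v + (-1, -1)
  odd : (D v).2 % 2 = 1 → D s = D v + (0, -1) ∧ D sr = D v + (1, -1) ∧ D sl = D v + (-1, -1) ∧
    D tr = D v + (1, 1) ∧ D tl = D v + (0, 1)

/-- Two vertices have a common face. -/
def Near {V : Type*} (𝓣 𝓠 : Set (Set V)) (v w : V) : Prop :=
  ∃ A, (A ∈ 𝓣 ∨ A ∈ 𝓠) ∧ v ∈ A ∧ w ∈ A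

section

variable {V : Type*} {𝓣 𝓠 : Set (Set V)} {v w r l s sr sl tr tl : V} {A B : Set V}

theorem Near.symm (h : Near 𝓣 𝓠 v w) : Near 𝓣 𝓠 w v := by
  obtain ⟨A, hA, h1, h2⟩ := h
  exact ⟨A, hA, h2, h1⟩

namespace IsStar

theorem near_iff (h : IsStar 𝓣 𝓠 v r l s sr sl tr tl) :
    Near 𝓣 𝓠 v w ↔ w = v ∨ w = r ∨ w = l ∨ w = s ∨ w = sr ∨ w = sl ∨ w = tr ∨ w = tl := by
  have h1 := h.exists_quad_iff (a := w)
  have h2 := h.exists_tri_iff (a := w)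
  have : Near 𝓣 𝓠 v w ↔ (∃ A ∈ 𝓣, v ∈ A ∧ w ∈ A) ∨ ∃ A ∈ 𝓠, v ∈ A ∧ w ∈ A := by
    simp only [Near, or_and_right, exists_or]
  rw [this, h1, h2]
  clear * -
  grind

theorem adjacent_iff (h : IsStar 𝓣 𝓠 v r l s sr sl tr tl) :
    Adjacent 𝓣 𝓠 v w ↔ w = r ∨ w = l ∨ w = s ∨ w = tr ∨ w = tl := by
  have hn := h.ne
  have hA₁ := (h.tri_iff {v, l, tl}).2 (by simp)
  have hA₂ := (h.tri_iff {v, tl, tr}).2 (by simp)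
  have hA₃ := (h.tri_iff {v, tr, r}).2 (by simp)
  have hB₁ := (h.quad_iff {v, r, sr, s}).2 (by simp)
  have hB₂ := (h.quad_iff {v, s, sl, l}).2 (by simp)
  constructor
  · rintro ⟨hvw, A, B, hAB, hA, hB, ⟨hvA, hwA⟩, hvB, hwB⟩
    have face : ∀ {C}, C ∈ 𝓣 ∨ C ∈ 𝓠 → v ∈ C →
        C = {v, l, tl} ∨ C = {v, tl, tr} ∨ C = {v, tr, r} ∨ C = {v, r, sr, s} ∨
        C = {v, s, sl, l} := by
      rintro C (hC | hC) hvC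
      · rcases (h.tri_iff C).1 ⟨hC, hvC⟩ with h | h | h <;> simp only [h, true_or, or_true]
      · rcases (h.quad_iff C).1 ⟨hC, hvC⟩ with h | h <;> simp only [h, true_or, or_true]
    -- only one face at `v` contains `sr`, and only one contains `sl`
    have hsr : ∀ {C}, C ∈ 𝓣 ∨ C ∈ 𝓠 → v ∈ C → sr ∈ C → C = {v, r, sr, s} := by
      intro C hC hvC hw
      rcases face hC hvC with rfl | rfl | rfl | rfl | rfl
      · clear * - hn hw; grind
      · clear * - hn hw; grind
      · clear * - hn hw; grind
      · rfl
      · clear * - hn hw; grind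
    have hsl : ∀ {C}, C ∈ 𝓣 ∨ C ∈ 𝓠 → v ∈ C → sl ∈ C → C = {v, s, sl, l} := by
      intro C hC hvC hw
      rcases face hC hvC with rfl | rfl | rfl | rfl | rfl
      · clear * - hn hw; grind
      · clear * - hn hw; grind
      · clear * - hn hw; grind
      · clear * - hn hw; grind
      · rfl
    rcases h.near_iff.1 ⟨A, hA, hvA, hwA⟩ with rfl | rfl | rfl | rfl | rfl | rfl | rfl | rfl
    · exact (hvw rfl).elim
    · simp only [true_or]
    · simp only [true_or, or_true]
    · simp only [true_or, or_true]
    · exact (hAB ((hsr hA hvA hwA).trans (hsr hB hvB hwB).symm)).elim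
    · exact (hAB ((hsl hA hvA hwA).trans (hsl hB hvB hwB).symm)).elim
    · simp only [true_or, or_true]
    · simp only [or_true]
  · have ne : ∀ {A B : Set V} (a : V), a ∈ A → a ∉ B → A ≠ B := fun a h h' e => h' (e ▸ h)
    rintro (rfl | rfl | rfl | rfl | rfl)
    · exact ⟨hn.1.1, _, _, ne tr (by simp) (by clear * - hn; grind), Or.inl hA₃.1, Or.inr hB₁.1,
        by simp, by simp⟩
    · exact ⟨hn.1.2.1, _, _, ne tl (by simp) (by clear * - hn; grind), Or.inl hA₁.1, Or.inr hB₂.1,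
        by simp, by simp⟩
    · exact ⟨hn.1.2.2.1, _, _, ne r (by simp) (by clear * - hn; grind), Or.inr hB₁.1,
        Or.inr hB₂.1, by simp, by simp⟩
    · exact ⟨hn.1.2.2.2.2.2.1, _, _, ne tl (by simp) (by clear * - hn; grind), Or.inl hA₂.1,
        Or.inl hA₃.1, by simp, by simp⟩
    · exact ⟨hn.1.2.2.2.2.2.2, _, _, ne l (by simp) (by clear * - hn; grind), Or.inl hA₁.1,
        Or.inl hA₂.1, by simp, by simp⟩

end IsStar

/-- Row number and horizontal position together map every star onto a star of the model. -/
theorem HasStars.exists_gridStar (hS : HasStars 𝓣 𝓠) (hH : TrivialCocycles 𝓣 𝓠) :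
    ∃ D : V → ℤ × ℤ, ∀ v, ∃ r l s sr sl tr tl, IsGridStar 𝓣 𝓠 D v r l s sr sl tr tl := by
  obtain ⟨T, hT⟩ := hS.exists_level hH
  obtain ⟨X, hX⟩ := hS.exists_position hH
  -- row `2 j` and row `2 j + 1` are shifted by `- j` half edges
  refine ⟨fun v => ((X v + T v / 2) / 2, T v), fun v => ?_⟩
  obtain ⟨r, l, s, sr, sl, tr, tl, hst, x1, x2, x3, x4, x5, x6, x7⟩ := hX v
  obtain ⟨t1, t2, t3, t4, t5, t6, t7⟩ := hT v r l s sr sl tr tl hst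
  rw [squarePartner_apply] at t3 t4 t5
  rw [trianglePartner_apply] at t6 t7
  refine ⟨r, l, s, sr, sl, tr, tl, hst, ?_, ?_, fun he => ?_, fun ho => ?_⟩
  · simp only [x1, t1, Prod.mk_add_mk, Prod.mk.injEq]
    omega
  · simp only [x2, t2, Prod.mk_add_mk, Prod.mk.injEq]
    omega
  · simp only at he
    rw [if_pos he] at t3 t4 t5 t6 t7
    simp only [x3, x4, x5, x6, x7, t3, t4, t5, t6, t7, Prod.mk_add_mk, Prod.mk.injEq]
    refine ⟨⟨?_, ?_⟩, ⟨?_, ?_⟩, ⟨?_, ?_⟩, ⟨?_, ?_⟩, ?_, ?_⟩ <;> first | trivial | omega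
  · simp only at ho
    rw [if_neg (by omega)] at t3 t4 t5 t6 t7
    simp only [x3, x4, x5, x6, x7, t3, t4, t5, t6, t7, Prod.mk_add_mk, Prod.mk.injEq]
    refine ⟨⟨?_, ?_⟩, ⟨?_, ?_⟩, ⟨?_, ?_⟩, ⟨?_, ?_⟩, ?_, ?_⟩ <;> first | trivial | omega

end

/-! ### The developing map on faces -/

/-- The vertices are connected through common faces. -/
def FaceConnected {V : Type*} (𝓣 𝓠 : Set (Set V)) : Prop :=
  ∀ S : Set V, S.Nonempty → (∀ v w, Near 𝓣 𝓠 v w → v ∈ S → w ∈ S) → S = univ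

section

variable {V : Type*} {𝓣 𝓠 : Set (Set V)} {v w r l s sr sl tr tl : V} {A B : Set V}
  {D : V → ℤ × ℤ}

namespace IsGridStar

/-- `D` is injective on the union of the faces at `v`. -/
theorem near_injective (h : IsGridStar 𝓣 𝓠 D v r l s sr sl tr tl) {w w' : V}
    (hw : Near 𝓣 𝓠 v w) (hw' : Near 𝓣 𝓠 v w') (hD : D w = D w') : w = w' := by
  obtain ⟨h0, h1, h2, h3, h4⟩ := h
  rw [h0.near_iff] at hw hw'
  rcases Int.emod_two_eq_zero_or_one (D v).2 with hp | hp
  · obtain ⟨e1, e2, e3, e4, e5⟩ := h3 hp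
    rcases hw with rfl | rfl | rfl | rfl | rfl | rfl | rfl | rfl <;>
    rcases hw' with rfl | rfl | rfl | rfl | rfl | rfl | rfl | rfl <;>
    first
    | rfl
    | simp [h1, h2, e1, e2, e3, e4, e5] at hD
  · obtain ⟨e1, e2, e3, e4, e5⟩ := h4 hp
    rcases hw with rfl | rfl | rfl | rfl | rfl | rfl | rfl | rfl <;>
    rcases hw' with rfl | rfl | rfl | rfl | rfl | rfl | rfl | rfl <;>
    first
    | rfl
    | simp [h1, h2, e1, e2, e3, e4, e5] at hD

/-- `D` maps the triangles at `v` onto the triangles of the model at `D v`. -/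
theorem tri_iff (h : IsGridStar 𝓣 𝓠 D v r l s sr sl tr tl) (B : Set (ℤ × ℤ)) :
    (∃ A ∈ 𝓣, v ∈ A ∧ D '' A = B) ↔ B ∈ gridTri ∧ D v ∈ B := by
  obtain ⟨h0, h1, h2, h3, h4⟩ := h
  have hex : (∃ A ∈ 𝓣, v ∈ A ∧ D '' A = B) ↔
      B = {D v, D l, D tl} ∨ B = {D v, D tl, D tr} ∨ B = {D v, D tr, D r} := by
    have : (∃ A ∈ 𝓣, v ∈ A ∧ D '' A = B) ↔ ∃ A, (A ∈ 𝓣 ∧ v ∈ A) ∧ D '' A = B := by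
      simp only [and_assoc]
    rw [this]
    simp only [h0.tri_iff, or_and_right, exists_or, exists_eq_left, image_insert_eq,
      image_singleton, eq_comm (b := B)]
  rw [hex, h1, h2]
  generalize D v = p at *
  obtain ⟨a, b⟩ := p
  simp only at h3 h4
  rcases Int.emod_two_eq_zero_or_one b with hp | hp
  · obtain ⟨-, -, -, e4, e5⟩ := h3 hp
    obtain ⟨j, rfl⟩ : ∃ j, b = 2 * j := ⟨b / 2, by omega⟩
    rw [e4, e5]
    simp only [Prod.mk_add_mk]
    constructor
    · rintro (rfl | rfl | rfl)
      · refine ⟨⟨a - 1, j, Or.inl ?_⟩, by simp⟩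
        grind
      · refine ⟨⟨a - 1, j, Or.inr ?_⟩, by simp⟩
        grind
      · refine ⟨⟨a, j, Or.inl ?_⟩, by simp⟩
        grind
    · rintro ⟨⟨k, i, rfl | rfl⟩, hm⟩
      · simp only [mem_insert_iff, mem_singleton_iff, Prod.mk.injEq] at hm
        rcases hm with ⟨rfl, hi⟩ | ⟨rfl, hi⟩ | ⟨rfl, hi⟩
        · obtain rfl : j = i := by omega
          right; right; grind
        · obtain rfl : j = i := by omega
          left; grind
        · omega
      · simp only [mem_insert_iff, mem_singleton_iff, Prod.mk.injEq] at hm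
        rcases hm with ⟨rfl, hi⟩ | ⟨rfl, hi⟩ | ⟨rfl, hi⟩
        · omega
        · omega
        · obtain rfl : j = i := by omega
          right; left; grind
  · obtain ⟨-, -, -, e4, e5⟩ := h4 hp
    obtain ⟨j, rfl⟩ : ∃ j, b = 2 * j - 1 := ⟨(b + 1) / 2, by omega⟩
    rw [e4, e5]
    simp only [Prod.mk_add_mk]
    constructor
    · rintro (rfl | rfl | rfl)
      · refine ⟨⟨a - 1, j, Or.inr ?_⟩, by simp⟩
        grind
      · refine ⟨⟨a, j, Or.inl ?_⟩, by simp⟩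
        grind
      · refine ⟨⟨a, j, Or.inr ?_⟩, by simp⟩
        grind
    · rintro ⟨⟨k, i, rfl | rfl⟩, hm⟩
      · simp only [mem_insert_iff, mem_singleton_iff, Prod.mk.injEq] at hm
        rcases hm with ⟨rfl, hi⟩ | ⟨rfl, hi⟩ | ⟨rfl, hi⟩
        · omega
        · omega
        · obtain rfl : j = i := by omega
          right; left; grind
      · simp only [mem_insert_iff, mem_singleton_iff, Prod.mk.injEq] at hm
        rcases hm with ⟨rfl, hi⟩ | ⟨rfl, hi⟩ | ⟨rfl, hi⟩
        · obtain rfl : j = i := by omega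
          right; right; grind
        · obtain rfl : j = i := by omega
          left; grind
        · omega

/-- `D` maps the quadrangles at `v` onto the quadrangles of the model at `D v`. -/
theorem quad_iff (h : IsGridStar 𝓣 𝓠 D v r l s sr sl tr tl) (B : Set (ℤ × ℤ)) :
    (∃ A ∈ 𝓠, v ∈ A ∧ D '' A = B) ↔ B ∈ gridQuad ∧ D v ∈ B := by
  obtain ⟨h0, h1, h2, h3, h4⟩ := h
  have hex : (∃ A ∈ 𝓠, v ∈ A ∧ D '' A = B) ↔
      B = {D v, D r, D sr, D s} ∨ B = {D v, D s, D sl, D l} := by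
    have : (∃ A ∈ 𝓠, v ∈ A ∧ D '' A = B) ↔ ∃ A, (A ∈ 𝓠 ∧ v ∈ A) ∧ D '' A = B := by
      simp only [and_assoc]
    rw [this]
    simp only [h0.quad_iff, or_and_right, exists_or, exists_eq_left, image_insert_eq,
      image_singleton, eq_comm (b := B)]
  rw [hex, h1, h2]
  generalize D v = p at *
  obtain ⟨a, b⟩ := p
  simp only at h3 h4
  rcases Int.emod_two_eq_zero_or_one b with hp | hp
  · obtain ⟨e1, e2, e3, -, -⟩ := h3 hp
    obtain ⟨j, rfl⟩ : ∃ j, b = 2 * j := ⟨b / 2, by omega⟩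
    rw [e1, e2, e3]
    simp only [Prod.mk_add_mk]
    constructor
    · rintro (rfl | rfl)
      · refine ⟨⟨a, j, ?_⟩, by simp⟩
        grind
      · refine ⟨⟨a - 1, j, ?_⟩, by simp⟩
        grind
    · rintro ⟨⟨k, i, rfl⟩, hm⟩
      simp only [mem_insert_iff, mem_singleton_iff, Prod.mk.injEq] at hm
      rcases hm with ⟨rfl, hi⟩ | ⟨rfl, hi⟩ | ⟨rfl, hi⟩ | ⟨rfl, hi⟩
      · obtain rfl : j = i := by omega
        left; grind
      · obtain rfl : j = i := by omega
        right; grind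
      · omega
      · omega
  · obtain ⟨e1, e2, e3, -, -⟩ := h4 hp
    obtain ⟨j, rfl⟩ : ∃ j, b = 2 * j + 1 := ⟨b / 2, by omega⟩
    rw [e1, e2, e3]
    simp only [Prod.mk_add_mk]
    constructor
    · rintro (rfl | rfl)
      · refine ⟨⟨a, j, ?_⟩, by simp⟩
        grind
      · refine ⟨⟨a - 1, j, ?_⟩, by simp⟩
        grind
    · rintro ⟨⟨k, i, rfl⟩, hm⟩
      simp only [mem_insert_iff, mem_singleton_iff, Prod.mk.injEq] at hm
      rcases hm with ⟨rfl, hi⟩ | ⟨rfl, hi⟩ | ⟨rfl, hi⟩ | ⟨rfl, hi⟩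
      · omega
      · omega
      · obtain rfl : j = i := by omega
        right; grind
      · obtain rfl : j = i := by omega
        left; grind

end IsGridStar

end

/-! ### Bijectivity of the developing map -/

section

variable {V : Type*} {𝓣 𝓠 : Set (Set V)} {v w r l s sr sl tr tl : V} {A B : Set V}
  {D : V → ℤ × ℤ}

theorem near_of_mem (hA : A ∈ 𝓣 ∨ A ∈ 𝓠) (hv : v ∈ A) (hw : w ∈ A) : Near 𝓣 𝓠 v w :=
  ⟨A, hA, hv, hw⟩

namespace IsGridStar

/-- The four unit steps from `v` in the model lift to steps between vertices with a common face. -/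
theorem exists_step (h : IsGridStar 𝓣 𝓠 D v r l s sr sl tr tl) :
    (∃ w, Near 𝓣 𝓠 v w ∧ D w = D v + (1, 0)) ∧ (∃ w, Near 𝓣 𝓠 v w ∧ D w = D v + (-1, 0)) ∧
    (∃ w, Near 𝓣 𝓠 v w ∧ D w = D v + (0, 1)) ∧ ∃ w, Near 𝓣 𝓠 v w ∧ D w = D v + (0, -1) := by
  refine ⟨⟨r, h.isStar.near_iff.2 (by simp), h.r_eq⟩,
    ⟨l, h.isStar.near_iff.2 (by simp), h.l_eq⟩, ?_⟩
  rcases Int.emod_two_eq_zero_or_one (D v).2 with hp | hp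
  · obtain ⟨e1, -, -, e4, -⟩ := h.even hp
    exact ⟨⟨s, h.isStar.near_iff.2 (by simp), e1⟩, ⟨tr, h.isStar.near_iff.2 (by simp), e4⟩⟩
  · obtain ⟨e1, -, -, -, e5⟩ := h.odd hp
    exact ⟨⟨tl, h.isStar.near_iff.2 (by simp), e5⟩, ⟨s, h.isStar.near_iff.2 (by simp), e1⟩⟩

/-- A step to the right and a step up commute: both ways run along the faces between two rows. -/
theorem exists_square (h : IsGridStar 𝓣 𝓠 D v r l s sr sl tr tl) :
    ∃ a b w, Near 𝓣 𝓠 v a ∧ Near 𝓣 𝓠 v b ∧ Near 𝓣 𝓠 a w ∧ Near 𝓣 𝓠 b w ∧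
      D a = D v + (1, 0) ∧ D b = D v + (0, 1) ∧ D w = D v + (1, 1) := by
  have hst := h.isStar
  rcases Int.emod_two_eq_zero_or_one (D v).2 with hp | hp
  · obtain ⟨e1, e2, -, -, -⟩ := h.even hp
    have hB := ((hst.quad_iff {v, r, sr, s}).2 (by simp)).1
    exact ⟨r, s, sr, near_of_mem (Or.inr hB) (by simp) (by simp),
      near_of_mem (Or.inr hB) (by simp) (by simp), near_of_mem (Or.inr hB) (by simp) (by simp),
      near_of_mem (Or.inr hB) (by simp) (by simp), h.r_eq, e1, e2⟩
  · obtain ⟨-, -, -, e4, e5⟩ := h.odd hp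
    have hA := ((hst.tri_iff {v, tr, r}).2 (by simp)).1
    have hB := ((hst.tri_iff {v, tl, tr}).2 (by simp)).1
    exact ⟨r, tl, tr, near_of_mem (Or.inl hA) (by simp) (by simp),
      near_of_mem (Or.inl hB) (by simp) (by simp), near_of_mem (Or.inl hA) (by simp) (by simp),
      near_of_mem (Or.inl hB) (by simp) (by simp), h.r_eq, e5, e4⟩

/-- A set that is closed under the unit steps of the model is closed under having a common face. -/
theorem mem_of_near (h : IsGridStar 𝓣 𝓠 D v r l s sr sl tr tl) (S : Set V)
    (hS : ∀ a b, a ∈ S → Near 𝓣 𝓠 a b →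
      D b = D a + (1, 0) ∨ D b = D a + (-1, 0) ∨ D b = D a + (0, 1) ∨ D b = D a + (0, -1) → b ∈ S)
    (hv : v ∈ S) (hw : Near 𝓣 𝓠 v w) : w ∈ S := by
  have hst := h.isStar
  have hA₁ := ((hst.tri_iff {v, l, tl}).2 (by simp)).1
  have hA₃ := ((hst.tri_iff {v, tr, r}).2 (by simp)).1
  have hB₁ := ((hst.quad_iff {v, r, sr, s}).2 (by simp)).1
  have hB₂ := ((hst.quad_iff {v, s, sl, l}).2 (by simp)).1
  have hr : r ∈ S := hS v r hv (near_of_mem (Or.inr hB₁) (by simp) (by simp)) (Or.inl h.r_eq)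
  have hl : l ∈ S := hS v l hv (near_of_mem (Or.inr hB₂) (by simp) (by simp))
    (Or.inr (Or.inl h.l_eq))
  have nrsr : Near 𝓣 𝓠 r sr := near_of_mem (Or.inr hB₁) (by simp) (by simp)
  have nlsl : Near 𝓣 𝓠 l sl := near_of_mem (Or.inr hB₂) (by simp) (by simp)
  have nrtr : Near 𝓣 𝓠 r tr := near_of_mem (Or.inl hA₃) (by simp) (by simp)
  have nltl : Near 𝓣 𝓠 l tl := near_of_mem (Or.inl hA₁) (by simp) (by simp)
  have nvs : Near 𝓣 𝓠 v s := near_of_mem (Or.inr hB₁) (by simp) (by simp)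
  have nvtr : Near 𝓣 𝓠 v tr := near_of_mem (Or.inl hA₃) (by simp) (by simp)
  have nvtl : Near 𝓣 𝓠 v tl := near_of_mem (Or.inl hA₁) (by simp) (by simp)
  have e1 := h.r_eq
  have e2 := h.l_eq
  have : s ∈ S ∧ sr ∈ S ∧ sl ∈ S ∧ tr ∈ S ∧ tl ∈ S := by
    rcases Int.emod_two_eq_zero_or_one (D v).2 with hp | hp
    · obtain ⟨e3, e4, e5, e6, e7⟩ := h.even hp
      exact ⟨hS v s hv nvs (by simp [e3]), hS r sr hr nrsr (by simp [e4, e1, add_assoc]),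
        hS l sl hl nlsl (by simp [e5, e2, add_assoc]), hS v tr hv nvtr (by simp [e6]),
        hS l tl hl nltl (by simp [e7, e2, add_assoc])⟩
    · obtain ⟨e3, e4, e5, e6, e7⟩ := h.odd hp
      exact ⟨hS v s hv nvs (by simp [e3]), hS r sr hr nrsr (by simp [e4, e1, add_assoc]),
        hS l sl hl nlsl (by simp [e5, e2, add_assoc]),
        hS r tr hr nrtr (by simp [e6, e1, add_assoc]),
        hS v tl hv nvtl (by simp [e7])⟩
  rcases hst.near_iff.1 hw with rfl | rfl | rfl | rfl | rfl | rfl | rfl | rfl <;> tauto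

end IsGridStar

/-- A map that sends every star onto a star of the model is bijective: the unit steps of the model
lift to commuting permutations of the vertices, which generate a transitive group. -/
theorem bijective_of_gridStar [Nonempty V] (hK : FaceConnected 𝓣 𝓠)
    (hD : ∀ v, ∃ r l s sr sl tr tl, IsGridStar 𝓣 𝓠 D v r l s sr sl tr tl) :
    Function.Bijective D := by
  have hinj : ∀ {v w w'}, Near 𝓣 𝓠 v w → Near 𝓣 𝓠 v w' → D w = D w' → w = w' := by
    intro v w w'
    obtain ⟨r, l, s, sr, sl, tr, tl, h⟩ := hD v
    exact h.near_injective
  have hstep : ∀ v, (∃ w, Near 𝓣 𝓠 v w ∧ D w = D v + (1, 0)) ∧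
      (∃ w, Near 𝓣 𝓠 v w ∧ D w = D v + (-1, 0)) ∧
      (∃ w, Near 𝓣 𝓠 v w ∧ D w = D v + (0, 1)) ∧ ∃ w, Near 𝓣 𝓠 v w ∧ D w = D v + (0, -1) := by
    intro v
    obtain ⟨r, l, s, sr, sl, tr, tl, h⟩ := hD v
    exact h.exists_step
  choose R hR using fun v => (hstep v).1
  choose L hL using fun v => (hstep v).2.1
  choose U hU using fun v => (hstep v).2.2.1
  choose W hW using fun v => (hstep v).2.2.2
  -- the unit steps `ρ` to the right and `υ` upwards
  let ρ : Equiv.Perm V := ⟨R, L,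
    fun v => hinj (hL (R v)).1 (hR v).1.symm (by rw [(hL _).2, (hR v).2]; simp [add_assoc]),
    fun v => hinj (hR (L v)).1 (hL v).1.symm (by rw [(hR _).2, (hL v).2]; simp [add_assoc])⟩
  let υ : Equiv.Perm V := ⟨U, W,
    fun v => hinj (hW (U v)).1 (hU v).1.symm (by rw [(hW _).2, (hU v).2]; simp [add_assoc]),
    fun v => hinj (hU (W v)).1 (hW v).1.symm (by rw [(hU _).2, (hW v).2]; simp [add_assoc])⟩
  have hcomm : Commute ρ υ := by
    ext v
    obtain ⟨r, l, s, sr, sl, tr, tl, h⟩ := hD v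
    obtain ⟨a, b, w, ha, hb, haw, hbw, ea, eb, ew⟩ := h.exists_square
    have h1 : R v = a := hinj (hR v).1 ha (by rw [(hR v).2, ea])
    have h2 : U v = b := hinj (hU v).1 hb (by rw [(hU v).2, eb])
    have h3 : U a = w := hinj (hU a).1 haw (by rw [(hU a).2, ea, ew]; simp [add_assoc])
    have h4 : R b = w := hinj (hR b).1 hbw (by rw [(hR b).2, eb, ew]; simp [add_assoc])
    change R (U v) = U (R v)
    rw [h1, h2, h3, h4]
  have hρ : ∀ (m : ℤ) v, D ((ρ ^ m) v) = D v + (m, 0) := by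
    intro m
    induction m with
    | zero => intro v; simp
    | succ n ih =>
      intro v
      rw [zpow_add_one, Equiv.Perm.mul_apply, ih]
      change D (R v) + _ = _
      rw [(hR v).2, add_assoc]
      simp [add_comm]
    | pred n ih =>
      intro v
      rw [zpow_sub_one, Equiv.Perm.mul_apply, ih]
      change D (L v) + _ = _
      rw [(hL v).2, add_assoc]
      simp [add_comm, sub_eq_add_neg]
  have hυ : ∀ (m : ℤ) v, D ((υ ^ m) v) = D v + (0, m) := by
    intro m
    induction m with
    | zero => intro v; simp
    | succ n ih =>
      intro v
      rw [zpow_add_one, Equiv.Perm.mul_apply, ih]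
      change D (U v) + _ = _
      rw [(hU v).2, add_assoc]
      simp [add_comm]
    | pred n ih =>
      intro v
      rw [zpow_sub_one, Equiv.Perm.mul_apply, ih]
      change D (W v) + _ = _
      rw [(hW v).2, add_assoc]
      simp [add_comm, sub_eq_add_neg]
  obtain ⟨v₀⟩ := ‹Nonempty V›
  have hDv : ∀ m n : ℤ, D ((ρ ^ m * υ ^ n) v₀) = D v₀ + (m, n) := by
    intro m n
    rw [Equiv.Perm.mul_apply, hρ, hυ, add_assoc]
    simp
  -- by connectedness, the orbit of `v₀` under the group generated by `ρ` and `υ` is everything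
  have horb : {w | ∃ m n : ℤ, w = (ρ ^ m * υ ^ n) v₀} = univ := by
    refine hK _ ⟨v₀, 0, 0, by simp⟩ fun v w hvw hv => ?_
    obtain ⟨r, l, s, sr, sl, tr, tl, h⟩ := hD v
    refine h.mem_of_near _ ?_ hv hvw
    rintro a b ⟨m, n, rfl⟩ hab (hb | hb | hb | hb)
    · refine ⟨1 + m, n, ?_⟩
      rw [zpow_add, zpow_one, mul_assoc, Equiv.Perm.mul_apply ρ]
      exact hinj hab (hR _).1 (hb.trans (hR _).2.symm)
    · refine ⟨-1 + m, n, ?_⟩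
      rw [zpow_add, zpow_neg_one, mul_assoc, Equiv.Perm.mul_apply ρ⁻¹]
      exact hinj hab (hL _).1 (hb.trans (hL _).2.symm)
    · refine ⟨m, 1 + n, ?_⟩
      rw [zpow_add, zpow_one, ← mul_assoc, (hcomm.zpow_left m).eq, mul_assoc,
        Equiv.Perm.mul_apply υ]
      exact hinj hab (hU _).1 (hb.trans (hU _).2.symm)
    · refine ⟨m, -1 + n, ?_⟩
      rw [zpow_add, zpow_neg_one, ← mul_assoc, (hcomm.zpow_left m).inv_right.eq, mul_assoc,
        Equiv.Perm.mul_apply υ⁻¹]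
      exact hinj hab (hW _).1 (hb.trans (hW _).2.symm)
  refine ⟨fun v w hvw => ?_, fun p => ?_⟩
  · obtain ⟨m, n, rfl⟩ : v ∈ {w | ∃ m n : ℤ, w = (ρ ^ m * υ ^ n) v₀} := horb ▸ mem_univ v
    obtain ⟨m', n', rfl⟩ : w ∈ {w | ∃ m n : ℤ, w = (ρ ^ m * υ ^ n) v₀} := horb ▸ mem_univ w
    rw [hDv, hDv, add_right_inj, Prod.mk.injEq] at hvw
    rw [hvw.1, hvw.2]
  · exact ⟨(ρ ^ (p.1 - (D v₀).1) * υ ^ (p.2 - (D v₀).2)) v₀, by rw [hDv]; ext <;> simp⟩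

/-- A face-connected complex with trivial cocycles in which every vertex has a star is isomorphic to
the model on `ℤ × ℤ`. -/
theorem HasStars.exists_equiv_grid [Nonempty V] (hS : HasStars 𝓣 𝓠) (hH : TrivialCocycles 𝓣 𝓠)
    (hK : FaceConnected 𝓣 𝓠) (hne : ∀ A, A ∈ 𝓣 ∨ A ∈ 𝓠 → A.Nonempty) :
    ∃ D : V ≃ ℤ × ℤ, (∀ A, A ∈ 𝓣 ↔ D '' A ∈ gridTri) ∧ (∀ A, A ∈ 𝓠 ↔ D '' A ∈ gridQuad) ∧
      ∀ v w, Adjacent 𝓣 𝓠 v w ↔ {D v, D w} ∈ gridEdge := by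
  obtain ⟨D, hD⟩ := hS.exists_gridStar hH
  have hb := bijective_of_gridStar hK hD
  refine ⟨Equiv.ofBijective D hb, fun A => ⟨fun hA => ?_, fun hA => ?_⟩,
    fun A => ⟨fun hA => ?_, fun hA => ?_⟩, fun v w => ?_⟩
  · obtain ⟨v, hv⟩ := hne A (Or.inl hA)
    obtain ⟨r, l, s, sr, sl, tr, tl, h⟩ := hD v
    exact ((h.tri_iff _).1 ⟨A, hA, hv, rfl⟩).1
  · obtain ⟨v, hv⟩ : A.Nonempty := by
      rw [← image_nonempty (f := D)]
      change D '' A ∈ gridTri at hA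
      obtain ⟨k, j, h | h⟩ := hA <;> rw [h] <;> exact insert_nonempty _ _
    obtain ⟨r, l, s, sr, sl, tr, tl, h⟩ := hD v
    obtain ⟨A', hA', -, he⟩ := (h.tri_iff _).2 ⟨hA, mem_image_of_mem D hv⟩
    rwa [← hb.1.image_injective he]
  · obtain ⟨v, hv⟩ := hne A (Or.inr hA)
    obtain ⟨r, l, s, sr, sl, tr, tl, h⟩ := hD v
    exact ((h.quad_iff _).1 ⟨A, hA, hv, rfl⟩).1
  · obtain ⟨v, hv⟩ : A.Nonempty := by
      rw [← image_nonempty (f := D)]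
      change D '' A ∈ gridQuad at hA
      obtain ⟨k, j, h⟩ := hA
      rw [h]
      exact insert_nonempty _ _
    obtain ⟨r, l, s, sr, sl, tr, tl, h⟩ := hD v
    obtain ⟨A', hA', -, he⟩ := (h.quad_iff _).2 ⟨hA, mem_image_of_mem D hv⟩
    rwa [← hb.1.image_injective he]
  · obtain ⟨r, l, s, sr, sl, tr, tl, h⟩ := hD v
    rw [h.isStar.adjacent_iff, pair_mem_gridEdge]
    simp only [Equiv.ofBijective_apply]
    have e1 := h.r_eq
    have e2 := h.l_eq
    have hp := Int.emod_two_eq_zero_or_one (D v).2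
    have he := h.even
    have ho := h.odd
    simp only [Prod.ext_iff, Prod.fst_add, Prod.snd_add] at e1 e2 he ho
    constructor
    · intro hw
      clear hD hS hH hK hne h
      rcases hp with hp | hp
      · obtain ⟨e3, -, -, e4, e5⟩ := he hp
        clear he ho
        rcases hw with rfl | rfl | rfl | rfl | rfl
        · left; omega
        · left; omega
        · right; left; omega
        · right; left; omega
        · right; right; right; omega
      · obtain ⟨e3, -, -, e4, e5⟩ := ho hp
        clear he ho
        rcases hw with rfl | rfl | rfl | rfl | rfl
        · left; omega
        · left; omega
        · right; left; omega
        · right; right; left; omega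
        · right; left; omega
    · have key : ∀ x, (D w).1 = (D x).1 → (D w).2 = (D x).2 → w = x := fun x h1 h2 =>
        hb.1 (Prod.ext h1 h2)
      clear h hD hS hH hK hne hb
      rcases hp with hp | hp
      · obtain ⟨e3, -, -, e4, e5⟩ := he hp
        clear he ho
        rintro (⟨h1, h2 | h2⟩ | ⟨h1, h2 | h2⟩ | ⟨h0, h1, h2⟩ | ⟨h0, h1, h2⟩)
        · exact Or.inl (key r (by omega) (by omega))
        · exact Or.inr (Or.inl (key l (by omega) (by omega)))
        · exact Or.inr (Or.inr (Or.inl (key s (by omega) (by omega))))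
        · exact Or.inr (Or.inr (Or.inr (Or.inl (key tr (by omega) (by omega)))))
        · omega
        · exact Or.inr (Or.inr (Or.inr (Or.inr (key tl (by omega) (by omega)))))
      · obtain ⟨e3, -, -, e4, e5⟩ := ho hp
        clear he ho
        rintro (⟨h1, h2 | h2⟩ | ⟨h1, h2 | h2⟩ | ⟨h0, h1, h2⟩ | ⟨h0, h1, h2⟩)
        · exact Or.inl (key r (by omega) (by omega))
        · exact Or.inr (Or.inl (key l (by omega) (by omega)))
        · exact Or.inr (Or.inr (Or.inr (Or.inr (key tl (by omega) (by omega)))))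
        · exact Or.inr (Or.inr (Or.inl (key s (by omega) (by omega))))
        · exact Or.inr (Or.inr (Or.inr (Or.inl (key tr (by omega) (by omega)))))
        · omega

end

/-! ### The stars of a semi-equivelar map -/

theorem Set.eq_triple_of_ncard {α : Type*} {S : Set α} {a b c : α} (hS : S.ncard = 3) (ha : a ∈ S)
    (hb : b ∈ S) (hc : c ∈ S) (hab : a ≠ b) (hac : a ≠ c) (hbc : b ≠ c) : S = {a, b, c} := by
  have hf : S.Finite := finite_of_ncard_ne_zero (by omega)
  refine (eq_of_subset_of_ncard_le ?_ ?_ hf).symm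
  · rintro x (rfl | rfl | rfl) <;> assumption
  · rw [hS, ncard_eq_three.2 ⟨a, b, c, hab, hac, hbc, rfl⟩]

theorem Set.exists_eq_quadruple_of_ncard {α : Type*} {S : Set α} {a b c : α} (hS : S.ncard = 4)
    (ha : a ∈ S) (hb : b ∈ S) (hc : c ∈ S) (hab : a ≠ b) (hac : a ≠ c) (hbc : b ≠ c) :
    ∃ d, d ≠ a ∧ d ≠ b ∧ d ≠ c ∧ S = {a, b, d, c} := by
  have hf : S.Finite := finite_of_ncard_ne_zero (by omega)
  have hsub : ({a, b, c} : Set α) ⊆ S := by rintro x (rfl | rfl | rfl) <;> assumption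
  have h3 : ({a, b, c} : Set α).ncard = 3 := ncard_eq_three.2 ⟨a, b, c, hab, hac, hbc, rfl⟩
  have h1 : (S \ {a, b, c}).ncard = 1 := by
    rw [ncard_sdiff hsub (by simp), hS, h3]
  obtain ⟨d, hd⟩ := ncard_eq_one.1 h1
  have hdS : d ∈ S \ {a, b, c} := hd ▸ mem_singleton d
  have hn := hdS.2
  simp only [mem_insert_iff, mem_singleton_iff, not_or] at hn
  refine ⟨d, hn.1, hn.2.1, hn.2.2, ?_⟩
  rw [← union_sdiff_cancel hsub, hd]
  ext x
  simp only [mem_union, mem_insert_iff, mem_singleton_iff]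
  tauto

namespace CellFamily

/-- The vertex sets of the `p`-gonal faces. -/
def faceSets {M : Type*} (X : CellFamily M) (p : ℕ) : Set (Set X.verts) :=
  {A | ∃ F ∈ X.faces, X.gonality F = p ∧ A = Subtype.val ⁻¹' F}

namespace IsPolyhedralMap

variable {M : Type*} [TopologicalSpace M] {X : CellFamily M} (hX : X.IsPolyhedralMap)
include hX

/-- The face-cycle at a vertex gives its star. Let `w i` be the other end point of the edge between
the faces `C i` and `C (i + 1)`; these five vertices and the fourth vertices of the two quadrangles
are distinct, because a face contains only two of the edges at the vertex. -/
theorem hasStars (ht : X.IsSemiEquivelar ![3, 3, 3, 4, 4]) :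
    HasStars (X.faceSets 3) (X.faceSets 4) := by
  intro v
  obtain ⟨C, ⟨-, hCr, hCe, hei⟩, hg⟩ := ht v v.2
  have hCf : ∀ i, C i ∈ X.faces ∧ (v : M) ∈ C i := fun i => by
    have : C i ∈ range C := mem_range_self i
    rwa [hCr] at this
  have hve : ∀ i, (v : M) ∈ C i ∩ C (i + 1) := fun i => ⟨(hCf i).2, (hCf (i + 1)).2⟩
  -- `w i` is the other end point of the edge between the faces `i` and `i + 1`
  have hw : ∀ i, ∃ w : X.verts, w ≠ v ∧ (C i ∩ C (i + 1)) ∩ X.verts = {(v : M), (w : M)} := by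
    intro i
    obtain ⟨a, b, hab, h⟩ := hX.exists_edge_verts (hCe i)
    have hv : (v : M) ∈ (C i ∩ C (i + 1)) ∩ X.verts := ⟨hve i, v.2⟩
    have ha : a ∈ (C i ∩ C (i + 1)) ∩ X.verts := h ▸ Or.inl rfl
    have hb : b ∈ (C i ∩ C (i + 1)) ∩ X.verts := h ▸ Or.inr rfl
    rw [h] at hv
    rcases hv with hv | hv
    · exact ⟨⟨b, hb.2⟩, fun e => hab (hv.symm.trans (congrArg Subtype.val e).symm), by rw [h, hv]⟩
    · exact ⟨⟨a, ha.2⟩, fun e => hab ((congrArg Subtype.val e).trans hv),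
        by rw [h, hv, pair_comm]⟩
  choose w hwv hwe using hw
  have hwm : ∀ i, ((w i : M) ∈ C i ∧ (w i : M) ∈ C (i + 1)) := fun i => by
    have : (w i : M) ∈ (C i ∩ C (i + 1)) ∩ X.verts := hwe i ▸ Or.inr rfl
    exact this.1
  have hwi : Function.Injective w := fun i j hij => hei
    (hX.edge_eq_of_verts_eq (hCe i) (hCe j) (by rw [hwe, hwe, hij]))
  -- the face `i` contains only two of the edges at `v`
  have key : ∀ i j, (w j : M) ∈ C i → j = i ∨ j = i - 1 := by
    intro i j hj
    by_contra! hc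
    have hsub : C j ∩ C (j + 1) ⊆ C i := hX.edge_subset_face (hCf i).1 (hCe j) (by
      rw [hwe]
      rintro x (rfl | rfl)
      exacts [(hCf i).2, hj])
    have hsub' : C (i - 1) ∩ C (i - 1 + 1) ⊆ C i := by
      rw [sub_add_cancel]
      exact inter_subset_right
    have := hX.not_three_edges (hCf i).1 v.2 (hCe j) (hCe i) (hCe (i - 1)) hsub inter_subset_left
      hsub' (hve _) (hve _) (hve _) (hei.ne hc.1) (hei.ne hc.2)
    have h1 : i = i - 1 := hei this
    exact absurd (sub_eq_self.1 h1.symm) (by decide)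
  have hw' : ∀ i, (w (i - 1) : M) ∈ C i := fun i => by simpa using (hwm (i - 1)).2
  have hwne : ∀ i j, i ≠ j → (w i : M) ≠ w j := fun i j hij h => hij (hwi (Subtype.ext h))
  have hwv' : ∀ i, (v : M) ≠ w i := fun i h => hwv i (Subtype.ext h).symm
  have htri : ∀ i, X.gonality (C i) = 3 → C i ∩ X.verts = {(v : M), ↑(w (i - 1)), ↑(w i)} := by
    intro i hi
    exact Set.eq_triple_of_ncard hi ⟨(hCf i).2, v.2⟩ ⟨hw' i, (w _).2⟩ ⟨(hwm i).1, (w _).2⟩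
      (hwv' _) (hwv' _) (hwne _ _ (by simp))
  have hquad : ∀ i, X.gonality (C i) = 4 → ∃ q : X.verts, q ≠ v ∧ (q : M) ∈ C i ∧
      (∀ j, q ≠ w j) ∧ C i ∩ X.verts = {(v : M), ↑(w (i - 1)), ↑q, ↑(w i)} := by
    intro i hi
    obtain ⟨q, h1, h2, h3, h4⟩ := Set.exists_eq_quadruple_of_ncard hi ⟨(hCf i).2, v.2⟩
      ⟨hw' i, (w _).2⟩ ⟨(hwm i).1, (w _).2⟩ (hwv' _) (hwv' _) (hwne _ _ (by simp))
    have hq : q ∈ C i ∩ X.verts := h4 ▸ (by simp)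
    refine ⟨⟨q, hq.2⟩, fun h => h1 (congrArg Subtype.val h), hq.1, fun j hj => ?_, h4⟩
    have hqj : q = w j := congrArg Subtype.val hj
    rcases key i j (hqj ▸ hq.1) with rfl | rfl
    · exact h3 hqj
    · exact h2 hqj
  obtain ⟨q, hqv, hqC, hqw, hq⟩ := hquad 3 (hg 3)
  obtain ⟨p, hpv, hpC, hpw, hp⟩ := hquad 4 (hg 4)
  have hqp : q ≠ p := by
    rintro rfl
    have : (q : M) ∈ (C 3 ∩ C (3 + 1)) ∩ X.verts := ⟨⟨hqC, hpC⟩, q.2⟩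
    rw [hwe] at this
    rcases this with h | h
    · exact hqv (Subtype.ext h)
    · exact hqw 3 (Subtype.ext h)
  have hpre : ∀ {F G : Set M}, F ∩ X.verts = G →
      (Subtype.val ⁻¹' F : Set X.verts) = Subtype.val ⁻¹' G := by
    rintro F G rfl
    ext x
    simp
  have hC0 : (Subtype.val ⁻¹' C 0 : Set X.verts) = {v, w 4, w 0} := by
    rw [hpre (htri 0 (hg 0))]; ext x; simp [Subtype.ext_iff]; rfl
  have hC1 : (Subtype.val ⁻¹' C 1 : Set X.verts) = {v, w 0, w 1} := by
    rw [hpre (htri 1 (hg 1))]; ext x; simp [Subtype.ext_iff]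
  have hC2 : (Subtype.val ⁻¹' C 2 : Set X.verts) = {v, w 1, w 2} := by
    rw [hpre (htri 2 (hg 2))]; ext x; simp [Subtype.ext_iff]
  have hC3 : (Subtype.val ⁻¹' C 3 : Set X.verts) = {v, w 2, q, w 3} := by
    rw [hpre hq]; ext x; simp [Subtype.ext_iff]
  have hC4 : (Subtype.val ⁻¹' C 4 : Set X.verts) = {v, w 3, p, w 4} := by
    rw [hpre hp]; ext x; simp [Subtype.ext_iff]
  have hface : ∀ F ∈ X.faces, (v : M) ∈ F → ∃ i, C i = F := fun F hF hv => by
    have : F ∈ range C := hCr ▸ ⟨hF, hv⟩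
    exact this
  refine ⟨w 2, w 4, w 3, q, p, w 1, w 0, ?_, fun A => ?_, fun A => ?_⟩
  · have h : ∀ i j, i ≠ j → w i ≠ w j := fun i j hij => hwi.ne hij
    have hvw : ∀ i, v ≠ w i := fun i => (hwv i).symm
    have hwq : ∀ i, w i ≠ q := fun i => (hqw i).symm
    have hwp : ∀ i, w i ≠ p := fun i => (hpw i).symm
    simp only [List.nodup_cons, List.mem_cons, List.not_mem_nil, not_or, or_false,
      not_false_eq_true, List.nodup_nil, and_true]
    simp [hvw, hwq, hwp, hqw, hpw, hqp, hqv.symm, hpv.symm, hwi.eq_iff]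
  · constructor
    · rintro ⟨⟨F, hF, hgF, rfl⟩, hv⟩
      obtain ⟨i, rfl⟩ := hface F hF hv
      have := hg i
      fin_cases i
      · exact Or.inl hC0
      · exact Or.inr (Or.inl hC1)
      · exact Or.inr (Or.inr hC2)
      · exact absurd (hgF.symm.trans this) (by simp)
      · exact absurd (hgF.symm.trans this) (by simp)
    · rintro (rfl | rfl | rfl)
      · exact ⟨⟨C 0, (hCf 0).1, hg 0, hC0.symm⟩, by simp⟩
      · exact ⟨⟨C 1, (hCf 1).1, hg 1, hC1.symm⟩, by simp⟩
      · exact ⟨⟨C 2, (hCf 2).1, hg 2, by rw [hC2, pair_comm]⟩, by simp⟩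
  · constructor
    · rintro ⟨⟨F, hF, hgF, rfl⟩, hv⟩
      obtain ⟨i, rfl⟩ := hface F hF hv
      have := hg i
      fin_cases i
      · exact absurd (hgF.symm.trans this) (by simp)
      · exact absurd (hgF.symm.trans this) (by simp)
      · exact absurd (hgF.symm.trans this) (by simp)
      · exact Or.inl hC3
      · exact Or.inr hC4
    · rintro (rfl | rfl)
      · exact ⟨⟨C 3, (hCf 3).1, hg 3, hC3.symm⟩, by simp⟩
      · exact ⟨⟨C 4, (hCf 4).1, hg 4, hC4.symm⟩, by simp⟩

end IsPolyhedralMap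

end CellFamily

/-! ### Cocycles, connectedness and edges of a semi-equivelar map -/

namespace CellFamily.IsPolyhedralMap

variable {M : Type*} [TopologicalSpace M] {X : CellFamily M} (hX : X.IsPolyhedralMap)
  (ht : X.IsSemiEquivelar ![3, 3, 3, 4, 4])
include hX ht

theorem gonality_eq_three_or_four {F : Set M} (hF : F ∈ X.faces) :
    X.gonality F = 3 ∨ X.gonality F = 4 := by
  obtain ⟨v, hv, hvF⟩ := hX.exists_vert_mem_face hF
  obtain ⟨C, ⟨-, hCr, -, -⟩, hg⟩ := ht v hv
  have : F ∈ range C := hCr ▸ ⟨hF, hvF⟩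
  obtain ⟨i, rfl⟩ := this
  rw [hg]
  fin_cases i <;> simp

theorem preimage_mem_faceSets {F : Set M} (hF : F ∈ X.faces) :
    (Subtype.val ⁻¹' F : Set X.verts) ∈ X.faceSets 3 ∨
      (Subtype.val ⁻¹' F : Set X.verts) ∈ X.faceSets 4 :=
  (hX.gonality_eq_three_or_four ht hF).imp (fun h => ⟨F, hF, h, rfl⟩) fun h => ⟨F, hF, h, rfl⟩

omit ht in
theorem nonempty_of_mem_faceSets {A : Set X.verts} {p : ℕ} (hA : A ∈ X.faceSets p) :
    A.Nonempty := by
  obtain ⟨F, hF, -, rfl⟩ := hA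
  obtain ⟨v, hv, hvF⟩ := hX.exists_vert_mem_face hF
  exact ⟨⟨v, hv⟩, hvF⟩

/-- Cocycles on the faces of a map on a simply connected space are trivial. -/
theorem trivialCocycles [T2Space M] [SimplyConnectedSpace M] [LocallyPathConnectedSpace M] :
    TrivialCocycles (X.faceSets 3) (X.faceSets 4) := by
  intro G _ g hg
  obtain ⟨h, hh⟩ := hX.exists_coboundary g fun F hF u v w hu hv hw =>
    hg _ (hX.preimage_mem_faceSets ht hF) u hu v hv w hw
  refine ⟨h, fun A hA u hu v hv => ?_⟩
  rcases hA with ⟨F, hF, -, rfl⟩ | ⟨F, hF, -, rfl⟩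
  · exact hh F hF u v hu hv
  · exact hh F hF u v hu hv

theorem faceConnected [T2Space M] [PreconnectedSpace M] :
    FaceConnected (X.faceSets 3) (X.faceSets 4) := fun S hS h =>
  hX.eq_univ_of_face_closed S hS fun _ hF u v hu hv huS =>
    h u v ⟨_, hX.preimage_mem_faceSets ht hF, hu, hv⟩ huS

/-- Every edge is the intersection of two faces. -/
theorem exists_eq_inter {e : Set M} (he : e ∈ X.edges) :
    ∃ F ∈ X.faces, ∃ G ∈ X.faces, F ≠ G ∧ e = F ∩ G := by
  obtain ⟨a, b, -, hab⟩ := hX.exists_edge_verts he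
  have ha : a ∈ e ∩ X.verts := hab ▸ Or.inl rfl
  obtain ⟨F, hF, heF⟩ := hX.exists_face_of_edge he
  obtain ⟨C, ⟨hCi, hCr, hCe, hei⟩, -⟩ := ht a ha.2
  have hCf : ∀ i, C i ∈ X.faces ∧ a ∈ C i := fun i => by
    have : C i ∈ range C := mem_range_self i
    rwa [hCr] at this
  have : F ∈ range C := hCr ▸ ⟨hF, heF ha.1⟩
  obtain ⟨i, rfl⟩ := this
  have hne : ∀ j : Fin 5, j ≠ j + 1 := fun j h => absurd (left_eq_add.1 h) (by decide)
  have hve : ∀ i, a ∈ C i ∩ C (i + 1) := fun i => ⟨(hCf i).2, (hCf (i + 1)).2⟩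
  by_cases h1 : e = C i ∩ C (i + 1)
  · exact ⟨_, hF, _, (hCf (i + 1)).1, hCi.ne (hne i), h1⟩
  by_cases h2 : e = C (i - 1) ∩ C (i - 1 + 1)
  · exact ⟨_, (hCf (i - 1)).1, _, (hCf (i - 1 + 1)).1, hCi.ne (hne _), h2⟩
  have hsub' : C (i - 1) ∩ C (i - 1 + 1) ⊆ C i := by
    rw [sub_add_cancel]
    exact inter_subset_right
  have h3 : i = i - 1 := hei (hX.not_three_edges hF ha.2 he (hCe i) (hCe (i - 1)) heF
    inter_subset_left hsub' ha.1 (hve _) (hve _) h1 h2)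
  exact absurd (sub_eq_self.1 h3.symm) (by decide)

/-- The edges are the pairs of distinct vertices with two common faces. -/
theorem exists_edge_iff_adjacent {v w : X.verts} :
    (v ≠ w ∧ ∃ e ∈ X.edges, (Subtype.val ⁻¹' e : Set X.verts) = {v, w}) ↔
      Adjacent (X.faceSets 3) (X.faceSets 4) v w := by
  constructor
  · rintro ⟨hvw, e, he, hev⟩
    obtain ⟨F, hF, G, hG, hFG, rfl⟩ := hX.exists_eq_inter ht he
    have hv : v ∈ (Subtype.val ⁻¹' (F ∩ G) : Set X.verts) := hev ▸ Or.inl rfl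
    have hw : w ∈ (Subtype.val ⁻¹' (F ∩ G) : Set X.verts) := hev ▸ Or.inr rfl
    refine ⟨hvw, _, _, fun h => hFG ?_, hX.preimage_mem_faceSets ht hF,
      hX.preimage_mem_faceSets ht hG, ⟨hv.1, hw.1⟩, hv.2, hw.2⟩
    refine hX.face_eq_of_verts_eq hF hG ?_
    rw [inter_comm F, inter_comm G, ← Subtype.image_preimage_coe, h, Subtype.image_preimage_coe]
  · rintro ⟨hvw, A, B, hAB, hA, hB, hvwA, hvwB⟩
    have face : ∀ {A}, A ∈ X.faceSets 3 ∨ A ∈ X.faceSets 4 →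
        ∃ F ∈ X.faces, A = Subtype.val ⁻¹' F := by
      rintro A (⟨F, hF, -, h⟩ | ⟨F, hF, -, h⟩) <;> exact ⟨F, hF, h⟩
    obtain ⟨F, hF, rfl⟩ := face hA
    obtain ⟨G, hG, rfl⟩ := face hB
    have hvw' : (v : M) ≠ w := fun h => hvw (Subtype.ext h)
    have he := hX.inter_mem_edges hF hG (fun h => hAB (h ▸ rfl)) hvw' ⟨hvwA.1, hvwB.1⟩
      ⟨hvwA.2, hvwB.2⟩
    refine ⟨hvw, _, he, ?_⟩
    have hev := hX.edge_verts_eq he hvw' ⟨⟨hvwA.1, hvwB.1⟩, v.2⟩ ⟨⟨hvwA.2, hvwB.2⟩, w.2⟩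
    ext x
    have : (x : M) ∈ F ∩ G ↔ (x : M) ∈ ({(v : M), (w : M)} : Set M) := by
      rw [← hev]
      exact ⟨fun h => ⟨h, x.2⟩, fun h => h.1⟩
    simpa [Subtype.ext_iff] using this

end CellFamily.IsPolyhedralMap

/-! ### The cells of the elongated triangular tiling -/

namespace ElongatedTriangular

/-- The vertex of the tiling with the combinatorial coordinates `p`. -/
noncomputable def vert (p : ℤ × ℤ) : EuclideanSpace ℝ (Fin 2) := u p.1 p.2

/-- The cell of the tiling spanned by the vertices in `B`. -/
noncomputable def cell (B : Set (ℤ × ℤ)) : Set (EuclideanSpace ℝ (Fin 2)) :=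
  convexHull ℝ (vert '' B)

/-- The height of the row `t`. -/
noncomputable def height (t : ℤ) : ℝ :=
  ((t / 2 : ℤ) : ℝ) * (1 + Real.sqrt 3 / 2) + ((t % 2 : ℤ) : ℝ)

theorem strictMono_height : StrictMono height := by
  refine strictMono_int_of_lt_succ fun t => ?_
  have h3 : (0 : ℝ) < Real.sqrt 3 := by positivity
  unfold height
  rcases Int.emod_two_eq_zero_or_one t with h | h
  · have h1 : (t + 1) / 2 = t / 2 := by omega
    have h2 : (t + 1) % 2 = 1 := by omega
    rw [h1, h2, h]
    norm_num
  · have h1 : (t + 1) / 2 = t / 2 + 1 := by omega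
    have h2 : (t + 1) % 2 = 0 := by omega
    rw [h1, h2, h]
    push_cast
    linarith

theorem vert_one (p : ℤ × ℤ) : vert p 1 = height p.2 := by
  simp [vert, u, height]

theorem vert_zero (p : ℤ × ℤ) : vert p 0 = ((2 * p.1 - p.2 / 2 : ℤ) : ℝ) / 2 := by
  simp [vert, u]
  ring

/-- The vertices in a cell lie in the bounding box of the vertices that span it. -/
theorem box_of_mem_cell {B : Set (ℤ × ℤ)} {t₀ t₁ a b : ℤ}
    (hB : ∀ q ∈ B, (t₀ ≤ q.2 ∧ q.2 ≤ t₁) ∧ a ≤ 2 * q.1 - q.2 / 2 ∧ 2 * q.1 - q.2 / 2 ≤ b)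
    {p : ℤ × ℤ} (hp : vert p ∈ cell B) :
    (t₀ ≤ p.2 ∧ p.2 ≤ t₁) ∧ a ≤ 2 * p.1 - p.2 / 2 ∧ 2 * p.1 - p.2 / 2 ≤ b := by
  have hbox : ∀ q : ℤ × ℤ,
      vert q ∈ ((EuclideanSpace.proj 1 : EuclideanSpace ℝ (Fin 2) →L[ℝ] ℝ).toLinearMap ⁻¹'
          Icc (height t₀) (height t₁) ∩
        (EuclideanSpace.proj 0 : EuclideanSpace ℝ (Fin 2) →L[ℝ] ℝ).toLinearMap ⁻¹'
          Icc ((a : ℝ) / 2) ((b : ℝ) / 2)) ↔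
      (t₀ ≤ q.2 ∧ q.2 ≤ t₁) ∧ a ≤ 2 * q.1 - q.2 / 2 ∧ 2 * q.1 - q.2 / 2 ≤ b := by
    intro q
    have h1 : ∀ m n : ℤ, (m : ℝ) / 2 ≤ (n : ℝ) / 2 ↔ m ≤ n := fun m n => by
      rw [div_le_div_iff_of_pos_right two_pos, Int.cast_le]
    change (vert q 1 ∈ Icc _ _ ∧ vert q 0 ∈ Icc _ _) ↔ _
    rw [vert_one, vert_zero, mem_Icc, mem_Icc, strictMono_height.le_iff_le,
      strictMono_height.le_iff_le, h1, h1]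
  rw [← hbox]
  refine convexHull_min ?_ (((convex_Icc _ _).linear_preimage _).inter
    ((convex_Icc _ _).linear_preimage _)) hp
  rintro _ ⟨q, hq, rfl⟩
  exact (hbox q).2 (hB q hq)

/-- The vertices in a cell are those that span it: its bounding box contains no other vertex. -/
theorem vert_mem_cell_iff {B : Set (ℤ × ℤ)} (hB : B ∈ gridEdge ∨ B ∈ gridTri ∨ B ∈ gridQuad)
    {p : ℤ × ℤ} : vert p ∈ cell B ↔ p ∈ B := by
  refine ⟨fun hp => ?_, fun hp => subset_convexHull ℝ _ (mem_image_of_mem _ hp)⟩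
  obtain ⟨x, t⟩ := p
  rcases hB with ⟨k, j, rfl | rfl | rfl | rfl⟩ | ⟨k, j, rfl | rfl⟩ | ⟨k, j, rfl⟩
  · have := box_of_mem_cell (t₀ := j) (t₁ := j) (a := 2 * k - j / 2) (b := 2 * k - j / 2 + 2)
      (by rintro q (rfl | rfl) <;> simp only <;> omega) hp
    simp only [mem_insert_iff, mem_singleton_iff, Prod.mk.injEq]
    omega
  · have := box_of_mem_cell (t₀ := 2 * j) (t₁ := 2 * j + 1) (a := 2 * k - j) (b := 2 * k - j)
      (by rintro q (rfl | rfl) <;> simp only <;> omega) hp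
    simp only [mem_insert_iff, mem_singleton_iff, Prod.mk.injEq]
    omega
  · have := box_of_mem_cell (t₀ := 2 * j - 1) (t₁ := 2 * j) (a := 2 * k - j) (b := 2 * k - j + 1)
      (by rintro q (rfl | rfl) <;> simp only <;> omega) hp
    simp only [mem_insert_iff, mem_singleton_iff, Prod.mk.injEq]
    omega
  · have := box_of_mem_cell (t₀ := 2 * j - 1) (t₁ := 2 * j) (a := 2 * k - j + 1)
      (b := 2 * k - j + 2) (by rintro q (rfl | rfl) <;> simp only <;> omega) hp
    simp only [mem_insert_iff, mem_singleton_iff, Prod.mk.injEq]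
    omega
  · have := box_of_mem_cell (t₀ := 2 * j - 1) (t₁ := 2 * j) (a := 2 * k - j)
      (b := 2 * k - j + 2) (by rintro q (rfl | rfl | rfl) <;> simp only <;> omega) hp
    simp only [mem_insert_iff, mem_singleton_iff, Prod.mk.injEq]
    omega
  · have := box_of_mem_cell (t₀ := 2 * j - 1) (t₁ := 2 * j) (a := 2 * k - j + 1)
      (b := 2 * k - j + 3) (by rintro q (rfl | rfl | rfl) <;> simp only <;> omega) hp
    simp only [mem_insert_iff, mem_singleton_iff, Prod.mk.injEq]
    omega
  · have := box_of_mem_cell (t₀ := 2 * j) (t₁ := 2 * j + 1) (a := 2 * k - j)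
      (b := 2 * k - j + 2) (by rintro q (rfl | rfl | rfl | rfl) <;> simp only <;> omega) hp
    simp only [mem_insert_iff, mem_singleton_iff, Prod.mk.injEq]
    omega

theorem injective_vert : Function.Injective vert := by
  intro p q h
  have h1 : p.2 = q.2 := strictMono_height.injective (by rw [← vert_one, ← vert_one, h])
  have h0 : vert p 0 = vert q 0 := by rw [h]
  rw [vert_zero, vert_zero, div_left_inj' two_ne_zero, Int.cast_inj, h1] at h0
  exact Prod.ext (by omega) h1

theorem mem_edges_iff {e : Set (EuclideanSpace ℝ (Fin 2))} :
    e ∈ tiling.edges ↔ ∃ B ∈ gridEdge, e = cell B := by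
  constructor
  · rintro ⟨k, j, h | h | h | h⟩
    · exact ⟨_, ⟨k, j, Or.inl rfl⟩, by rw [h, cell, image_pair, convexHull_pair]; rfl⟩
    · exact ⟨_, ⟨k, j, Or.inr (Or.inl rfl)⟩, by rw [h, cell, image_pair, convexHull_pair]; rfl⟩
    · exact ⟨_, ⟨k, j, Or.inr (Or.inr (Or.inl rfl))⟩,
        by rw [h, cell, image_pair, convexHull_pair]; rfl⟩
    · exact ⟨_, ⟨k, j, Or.inr (Or.inr (Or.inr rfl))⟩,
        by rw [h, cell, image_pair, convexHull_pair]; rfl⟩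
  · rintro ⟨B, ⟨k, j, rfl | rfl | rfl | rfl⟩, rfl⟩ <;>
    rw [cell, image_pair, convexHull_pair]
    · exact ⟨k, j, Or.inl rfl⟩
    · exact ⟨k, j, Or.inr (Or.inl rfl)⟩
    · exact ⟨k, j, Or.inr (Or.inr (Or.inl rfl))⟩
    · exact ⟨k, j, Or.inr (Or.inr (Or.inr rfl))⟩

theorem mem_faces_iff {F : Set (EuclideanSpace ℝ (Fin 2))} :
    F ∈ tiling.faces ↔ ∃ B, (B ∈ gridTri ∨ B ∈ gridQuad) ∧ F = cell B := by
  constructor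
  · rintro ⟨k, j, h | h | h⟩
    · exact ⟨_, Or.inr ⟨k, j, rfl⟩, by
        rw [h, cell, image_insert_eq, image_insert_eq, image_pair]; rfl⟩
    · exact ⟨_, Or.inl ⟨k, j, Or.inl rfl⟩, by rw [h, cell, image_insert_eq, image_pair]; rfl⟩
    · exact ⟨_, Or.inl ⟨k, j, Or.inr rfl⟩, by rw [h, cell, image_insert_eq, image_pair]; rfl⟩
  · rintro ⟨B, ⟨k, j, rfl | rfl⟩ | ⟨k, j, rfl⟩, rfl⟩
    · exact ⟨k, j, Or.inr (Or.inl (by rw [cell, image_insert_eq, image_pair]; rfl))⟩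
    · exact ⟨k, j, Or.inr (Or.inr (by rw [cell, image_insert_eq, image_pair]; rfl))⟩
    · exact ⟨k, j, Or.inl (by rw [cell, image_insert_eq, image_insert_eq, image_pair]; rfl)⟩

end ElongatedTriangular

/-! ### Comparison of the cells -/

/-- A bijection of the vertices that matches the vertex sets of the cells in `P` with those of the
cells in `Q` induces a bijection from `P` to `Q`, provided that cells are determined by their
vertices. -/
theorem exists_equiv_cells {M N : Type*} {S : Set M} {T : Set N} (φ : S ≃ T) {P : Set (Set M)}
    {Q : Set (Set N)}
    (hP : ∀ e ∈ P, ∀ e' ∈ P, (Subtype.val ⁻¹' e : Set S) = Subtype.val ⁻¹' e' → e = e')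
    (hQ : ∀ e ∈ Q, ∀ e' ∈ Q, (Subtype.val ⁻¹' e : Set T) = Subtype.val ⁻¹' e' → e = e')
    (h : ∀ A : Set S, (∃ e ∈ P, Subtype.val ⁻¹' e = A) ↔ ∃ e ∈ Q, Subtype.val ⁻¹' e = φ '' A) :
    ∃ f : P ≃ Q, ∀ e : P,
      (Subtype.val ⁻¹' (f e : Set N) : Set T) = φ '' (Subtype.val ⁻¹' (e : Set M)) := by
  choose f hfQ hf using fun e : P => (h (Subtype.val ⁻¹' (e : Set M))).1 ⟨e, e.2, rfl⟩
  refine ⟨Equiv.ofBijective (fun e => ⟨f e, hfQ e⟩) ⟨fun e e' hee => ?_, fun e' => ?_⟩, hf⟩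
  · refine Subtype.ext (hP _ e.2 _ e'.2 (φ.injective.image_injective ?_))
    rw [← hf, ← hf, show f e = f e' from congrArg Subtype.val hee]
  · obtain ⟨e, he, hee⟩ := (h (φ ⁻¹' (Subtype.val ⁻¹' (e' : Set N)))).2
      ⟨e', e'.2, (image_preimage_eq _ φ.surjective).symm⟩
    refine ⟨⟨e, he⟩, Subtype.ext (hQ _ (hfQ _) _ e'.2 ?_)⟩
    rw [hf, hee, image_preimage_eq _ φ.surjective]

namespace ElongatedTriangular

/-- The coordinates of the vertices of the tiling. -/
noncomputable def vertEquiv : ℤ × ℤ ≃ tiling.verts :=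
  Equiv.ofBijective (fun p => ⟨vert p, p.1, p.2, rfl⟩)
    ⟨fun _ _ h => injective_vert (congrArg Subtype.val h), fun ⟨_, k, t, h⟩ =>
      ⟨(k, t), Subtype.ext h.symm⟩⟩

theorem preimage_cell {B : Set (ℤ × ℤ)} (hB : B ∈ gridEdge ∨ B ∈ gridTri ∨ B ∈ gridQuad) :
    (Subtype.val ⁻¹' cell B : Set tiling.verts) = vertEquiv '' B := by
  ext x
  obtain ⟨p, rfl⟩ := vertEquiv.surjective x
  rw [vertEquiv.injective.mem_set_image]
  exact vert_mem_cell_iff hB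

theorem cell_subset_cell_iff {B B' : Set (ℤ × ℤ)}
    (hB : B ∈ gridEdge ∨ B ∈ gridTri ∨ B ∈ gridQuad)
    (hB' : B' ∈ gridEdge ∨ B' ∈ gridTri ∨ B' ∈ gridQuad) : cell B ⊆ cell B' ↔ B ⊆ B' :=
  ⟨fun h _ hp => (vert_mem_cell_iff hB').1 (h ((vert_mem_cell_iff hB).2 hp)),
    fun h => convexHull_mono (image_mono h)⟩

theorem cell_eq_of_preimage_eq {B B' : Set (ℤ × ℤ)}
    (hB : B ∈ gridEdge ∨ B ∈ gridTri ∨ B ∈ gridQuad)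
    (hB' : B' ∈ gridEdge ∨ B' ∈ gridTri ∨ B' ∈ gridQuad)
    (h : (Subtype.val ⁻¹' cell B : Set tiling.verts) = Subtype.val ⁻¹' cell B') :
    cell B = cell B' := by
  rw [preimage_cell hB, preimage_cell hB'] at h
  rw [vertEquiv.injective.image_injective h]

theorem exists_edge_iff {B : Set (ℤ × ℤ)} :
    (∃ e ∈ tiling.edges, (Subtype.val ⁻¹' e : Set tiling.verts) = vertEquiv '' B) ↔
      B ∈ gridEdge := by
  constructor
  · rintro ⟨e, he, h⟩
    obtain ⟨B', hB', rfl⟩ := mem_edges_iff.1 he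
    rw [preimage_cell (Or.inl hB')] at h
    exact vertEquiv.injective.image_injective h ▸ hB'
  · exact fun hB => ⟨_, mem_edges_iff.2 ⟨B, hB, rfl⟩, preimage_cell (Or.inl hB)⟩

theorem exists_face_iff {B : Set (ℤ × ℤ)} :
    (∃ F ∈ tiling.faces, (Subtype.val ⁻¹' F : Set tiling.verts) = vertEquiv '' B) ↔
      B ∈ gridTri ∨ B ∈ gridQuad := by
  constructor
  · rintro ⟨F, hF, h⟩
    obtain ⟨B', hB', rfl⟩ := mem_faces_iff.1 hF
    rw [preimage_cell (Or.inr hB')] at h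
    exact vertEquiv.injective.image_injective h ▸ hB'
  · exact fun hB => ⟨_, mem_faces_iff.2 ⟨B, hB, rfl⟩, preimage_cell (Or.inr hB)⟩

end ElongatedTriangular

namespace CellFamily.IsPolyhedralMap

variable {M : Type*} [TopologicalSpace M] {X : CellFamily M}

theorem nonempty_verts [Nonempty M] (hX : X.IsPolyhedralMap) : Nonempty X.verts := by
  obtain ⟨x⟩ := ‹Nonempty M›
  obtain ⟨F, hF, -⟩ : x ∈ ⋃₀ X.faces := hX.face_cover ▸ mem_univ x
  obtain ⟨v, hv, -⟩ := hX.exists_vert_mem_face hF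
  exact ⟨v, hv⟩

theorem edge_eq_of_preimage_eq (hX : X.IsPolyhedralMap) {e e' : Set M} (he : e ∈ X.edges)
    (he' : e' ∈ X.edges) (h : (Subtype.val ⁻¹' e : Set X.verts) = Subtype.val ⁻¹' e') :
    e = e' := by
  refine hX.edge_eq_of_verts_eq he he' ?_
  rw [inter_comm e, inter_comm e', ← Subtype.image_preimage_coe, h, Subtype.image_preimage_coe]

theorem face_eq_of_preimage_eq (hX : X.IsPolyhedralMap) {F G : Set M} (hF : F ∈ X.faces)
    (hG : G ∈ X.faces) (h : (Subtype.val ⁻¹' F : Set X.verts) = Subtype.val ⁻¹' G) : F = G := by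
  refine hX.face_eq_of_verts_eq hF hG ?_
  rw [inter_comm F, inter_comm G, ← Subtype.image_preimage_coe, h, Subtype.image_preimage_coe]

theorem exists_face_iff (hX : X.IsPolyhedralMap) (ht : X.IsSemiEquivelar ![3, 3, 3, 4, 4])
    {A : Set X.verts} :
    (∃ F ∈ X.faces, Subtype.val ⁻¹' F = A) ↔ A ∈ X.faceSets 3 ∨ A ∈ X.faceSets 4 := by
  constructor
  · rintro ⟨F, hF, rfl⟩
    exact hX.preimage_mem_faceSets ht hF
  · rintro (⟨F, hF, -, rfl⟩ | ⟨F, hF, -, rfl⟩) <;> exact ⟨F, hF, rfl⟩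

theorem exists_edge_iff (hX : X.IsPolyhedralMap) (ht : X.IsSemiEquivelar ![3, 3, 3, 4, 4])
    {A : Set X.verts} :
    (∃ e ∈ X.edges, Subtype.val ⁻¹' e = A) ↔
      ∃ v w, Adjacent (X.faceSets 3) (X.faceSets 4) v w ∧ A = {v, w} := by
  constructor
  · rintro ⟨e, he, rfl⟩
    obtain ⟨a, b, hab, hv⟩ := hX.exists_edge_verts he
    have ha : a ∈ e ∩ X.verts := hv ▸ Or.inl rfl
    have hb : b ∈ e ∩ X.verts := hv ▸ Or.inr rfl
    have h : (Subtype.val ⁻¹' e : Set X.verts) = {⟨a, ha.2⟩, ⟨b, hb.2⟩} := by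
      ext x
      have : (x : M) ∈ e ↔ (x : M) ∈ ({a, b} : Set M) := by
        rw [← hv]
        exact ⟨fun h => ⟨h, x.2⟩, fun h => h.1⟩
      simpa [Subtype.ext_iff] using this
    exact ⟨_, _, (hX.exists_edge_iff_adjacent ht).1
      ⟨fun h => hab (congrArg Subtype.val h), e, he, h⟩, h⟩
  · rintro ⟨v, w, hvw, rfl⟩
    exact ((hX.exists_edge_iff_adjacent ht).2 hvw).2

end CellFamily.IsPolyhedralMap

open ElongatedTriangular in
theorem mainTheorem4 (X : CellFamily (EuclideanSpace ℝ (Fin 2)))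
    (hX : X.IsPolyhedralMap) (ht : X.IsSemiEquivelar ![3, 3, 3, 4, 4]) :
    Nonempty (X.Iso ElongatedTriangular.tiling) := by
  have := hX.nonempty_verts
  obtain ⟨D, hT, hQ, hE⟩ := (hX.hasStars ht).exists_equiv_grid (hX.trivialCocycles ht)
    (hX.faceConnected ht) fun A hA => hA.elim hX.nonempty_of_mem_faceSets
      hX.nonempty_of_mem_faceSets
  obtain ⟨f, hf⟩ := exists_equiv_cells (D.trans vertEquiv) (P := X.edges) (Q := tiling.edges)
    (fun e he e' he' => hX.edge_eq_of_preimage_eq he he')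
    (fun e he e' he' h => by
      obtain ⟨B, hB, rfl⟩ := mem_edges_iff.1 he
      obtain ⟨B', hB', rfl⟩ := mem_edges_iff.1 he'
      exact cell_eq_of_preimage_eq (Or.inl hB) (Or.inl hB') h)
    (fun A => by
      rw [Equiv.coe_trans, image_comp, exists_edge_iff, hX.exists_edge_iff ht]
      constructor
      · rintro ⟨v, w, hvw, rfl⟩
        rw [image_pair]
        exact (hE v w).1 hvw
      · intro hA
        obtain ⟨p, q, hpq⟩ : ∃ p q, D '' A = {p, q} := by
          obtain ⟨k, j, h | h | h | h⟩ := hA <;> exact ⟨_, _, h⟩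
        obtain ⟨v, rfl⟩ := D.surjective p
        obtain ⟨w, rfl⟩ := D.surjective q
        exact ⟨v, w, (hE v w).2 (hpq ▸ hA),
          D.injective.image_injective (by rw [hpq, image_pair])⟩)
  obtain ⟨g, hg⟩ := exists_equiv_cells (D.trans vertEquiv) (P := X.faces) (Q := tiling.faces)
    (fun F hF G hG => hX.face_eq_of_preimage_eq hF hG)
    (fun F hF G hG h => by
      obtain ⟨B, hB, rfl⟩ := mem_faces_iff.1 hF
      obtain ⟨B', hB', rfl⟩ := mem_faces_iff.1 hG
      exact cell_eq_of_preimage_eq (Or.inr hB) (Or.inr hB') h)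
    (fun A => by
      rw [Equiv.coe_trans, image_comp, exists_face_iff, hX.exists_face_iff ht, hT, hQ])
  refine ⟨⟨D.trans vertEquiv, f, g, fun v e => ?_, fun v F => ?_, fun e F => ?_⟩⟩
  · change _ ↔ _ ∈ (Subtype.val ⁻¹' (f e : Set _) : Set tiling.verts)
    rw [hf, (D.trans vertEquiv).injective.mem_set_image]
    rfl
  · change _ ↔ _ ∈ (Subtype.val ⁻¹' (g F : Set _) : Set tiling.verts)
    rw [hg, (D.trans vertEquiv).injective.mem_set_image]
    rfl
  · -- on both sides, an edge lies in a face as soon as its vertices do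
    have hl : (e : Set (EuclideanSpace ℝ (Fin 2))) ⊆ F ↔
        (Subtype.val ⁻¹' (e : Set _) : Set X.verts) ⊆ Subtype.val ⁻¹' (F : Set _) :=
      ⟨fun h => preimage_mono h, fun h =>
        hX.edge_subset_face F.2 e.2 fun x hx => h (a := ⟨x, hx.2⟩) hx.1⟩
    have hr : (f e : Set (EuclideanSpace ℝ (Fin 2))) ⊆ g F ↔
        (Subtype.val ⁻¹' (f e : Set _) : Set tiling.verts) ⊆ Subtype.val ⁻¹' (g F : Set _) := by
      obtain ⟨B, hB, h⟩ := mem_edges_iff.1 (f e).2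
      obtain ⟨B', hB', h'⟩ := mem_faces_iff.1 (g F).2
      rw [h, h', preimage_cell (Or.inl hB), preimage_cell (Or.inr hB'),
        image_subset_image_iff vertEquiv.injective,
        cell_subset_cell_iff (Or.inl hB) (Or.inr hB')]
    rw [hl, hr, hf, hg, image_subset_image_iff (D.trans vertEquiv).injective]
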